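/- Let $m\ge 0$ and $n\ge 0$. Let $\omega(p)=\sqrt{|p|^2+m^2}$ for $p\in\mathbb R^3$, let $d\Omega_m(p)=d^3p/\omega(p)$, and let $\mathcal H=\bigoplus_{N\ge0}\mathcal H_N$ be the Fock space in which $\mathcal H_N$ consists of the symmetric square-integrable functions of $N$ momenta with respect to $\prod_k d\Omega_m(\xi_k)$; a momentum $\xi\in\mathbb R^3$ is identified with the four-vector $(\omega(\xi),\xi)$ on the mass hyperboloid. Let $\Phi_0=(1,0,0,\dots)$ be the vacuum. For $f\in\mathcal S(\mathbb R^4)$ put $\tilde f(p)=(2\pi)^{-2}\int e^{-ip\cdot x}f(x)\,d^4x$ with the Minkowski product $p\cdot x=p^0x^0-p^1x^1-p^2x^2-p^3x^3$. Let $\phi$ be the free neutral scalar field of mass $m$; its Wick powers are the unbounded operators on $\mathcal H$ given by $$({:}\phi^l{:}(f)\Phi)^{(N)}(\xi_1,\dots,\xi_N)=\frac{\pi^{l/2}}{(2\pi)^{2(l-1)}}\sum_{j=0}^{l}\Big[\frac{(N-l+2j)!}{N!}\Big]^{1/2}\sum_{\substack{S\subset\{1,\dots,N\}\\|S|=l-j}}\frac{l!}{j!}\int\prod_{r=1}^{j}d\Omega_m(\eta_r)\,\tilde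 f\Big(\sum_{r}\eta_r-\sum_{k\in S}\xi_k\Big)\Phi^{(N-l+2j)}\big(\eta_1,\dots,\eta_j,(\xi_k)_{k\notin S}\big)$$ on the domain of all $\Phi\in\mathcal H$ for which these integrals converge absolutely for almost all $\xi$ and the result lies in $\mathcal H$. Let $$D_m^{(-)}(z^0,\mathbf x)=\frac1{2(2\pi)^3}\int_{\mathbb R^3}\frac{e^{-i\omega(p)z^0+ip\cdot\mathbf x}}{\omega(p)}\,d^3p\qquad(\operatorname{Im}z^0<0).$$ Let $\sigma^{(i)}={:}e^{g_i\phi}{:}=\sum_{l\ge0}g_i^l\,{:}\phi^l{:}/l!$, a formal power series in the indeterminate $g_i$, for $i=1,\dots,n$. Then $$(\Phi_0,\sigma^{(1)}(x_1)\cdots\sigma^{(n)}(x_n)\Phi_0)=\exp\Big\{\sum_{1\le i<j\le n}g_ig_jt_{ij}\Big\},\qquad t_{ij}=D_m^{(-)}(x_i-x_j),$$ as an identity of formal power series in $g_1,\dots,g_n$ whose coefficients are distributions in $x_1,\dots,x_n$. That is, for all $f_1,\dots,f_n\in\mathcal S(\mathbb R^4)$ and all $k\in\mathbb N^n$: 1.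 $\Phi_0$ lies in the domain of ${:}\phi^{k_1}{:}(f_1)\cdots{:}\phi^{k_n}{:}(f_n)$. 2. Let $c_k(y;x)$ be the coefficient of $g_1^{k_1}\cdots g_n^{k_n}$ in the formal power series $\exp\{\sum_{i<j}g_ig_jD_m^{(-)}(z_i-z_j)\}$ with $z_i=(x_i^0+iy_i,\mathbf x_i)$. For all real $y_1<\dots<y_n$, the function $x\mapsto c_k(y;x)\prod_if_i(x_i)$ is integrable on $\mathbb R^{4n}$. 3. As $y\to0$ within $\{y_1<\dots<y_n\}$, $$\int_{\mathbb R^{4n}}c_k(y;x)\prod_{i=1}^nf_i(x_i)\,dx\ \longrightarrow\ \frac{1}{k_1!\cdots k_n!}\big(\Phi_0,{:}\phi^{k_1}{:}(f_1)\cdots{:}\phi^{k_n}{:}(f_n)\Phi_0\big).$$ -/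

import Mathlib

open MeasureTheory Filter Topology
open scoped SchwartzMap Nat

noncomputable section

namespace WickExp

/-! ### Kinematics -/

/-- Minkowski space `ℝ⁴`; the coordinate `0` is the time. -/
abbrev Spacetime : Type := EuclideanSpace ℝ (Fin 4)

/-- Three-dimensional momentum space. It parametrizes the mass hyperboloid
`ξ² = m²`, `ξ⁰ > 0` by the spatial part of the four-momentum. -/
abbrev Momentum : Type := EuclideanSpace ℝ (Fin 3)

/-- The relativistic energy `ω(p) = √(|p|² + m²)`. -/
def energy (m : ℝ) (p : Momentum) : ℝ := √(‖p‖ ^ 2 + m ^ 2)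

/-- The four-momentum `(ω(p), p)` on the mass hyperboloid. -/
def onShell (m : ℝ) (p : Momentum) : Spacetime :=
  !₂[energy m p, p 0, p 1, p 2]

/-- The Minkowski product `p⁰x⁰ - p¹x¹ - p²x² - p³x³`. -/
def mink (p x : Spacetime) : ℝ := p 0 * x 0 - p 1 * x 1 - p 2 * x 2 - p 3 * x 3

/-- The Lorentz invariant measure `dΩ_m = dξ¹dξ²dξ³ / √(|ξ|² + m²)` on the mass hyperboloid. -/
def Omega (m : ℝ) : Measure Momentum :=
  volume.withDensity fun p => ENNReal.ofReal (1 / energy m p)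

instance (m : ℝ) : SigmaFinite (Omega m) := by
  unfold Omega
  exact SigmaFinite.withDensity_ofReal _

/-- The product measure `∏ dΩ_m(ξ_k)` on families of momenta. -/
abbrev OmegaPi (m : ℝ) (ι : Type) [Fintype ι] : Measure (ι → Momentum) :=
  Measure.pi fun _ : ι => Omega m

/-- The Fourier transform `f̃(p) = (2π)⁻² ∫ e^{-ip·x} f(x) d⁴x`, with the Minkowski product. -/
def ftilde (f : 𝓢(Spacetime, ℂ)) (p : Spacetime) : ℂ :=
  ((2 * Real.pi : ℝ) : ℂ)⁻¹ ^ 2 * ∫ x : Spacetime, Complex.exp (-Complex.I * (mink p x : ℂ)) * f x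

/-- The two-point function at a point with complex time,
`D_m^{(-)}(z⁰, x) = [2(2π)³]⁻¹ ∫ ω(p)⁻¹ e^{-iω(p)z⁰} e^{ip·x} d³p`, given for `Im z⁰ < 0` by an
absolutely convergent integral. The point `(z⁰, x)` has `z⁰ = x⁰ + i s`. -/
def twoPoint (m : ℝ) (x : Spacetime) (s : ℝ) : ℂ :=
  ((2 * (2 * Real.pi) ^ 3 : ℝ) : ℂ)⁻¹ *
    ∫ p : Momentum, ((energy m p : ℝ) : ℂ)⁻¹ *
      Complex.exp (-Complex.I * (energy m p : ℂ) * ((x 0 : ℂ) + Complex.I * (s : ℂ))) *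
      Complex.exp (Complex.I * ((p 0 * x 1 + p 1 * x 2 + p 2 * x 3 : ℝ) : ℂ))

/-! ### Fock space -/

lemma quasi_comp (m : ℝ) {ι κ : Type} [Fintype ι] [Fintype κ] (g : κ → ι)
    (hg : Function.Injective g) :
    Measure.QuasiMeasurePreserving (fun ξ : ι → Momentum => ξ ∘ g) (OmegaPi m ι) (OmegaPi m κ) := by
  classical
  have h1 := measurePreserving_piEquivPiSubtypeProd (fun _ : ι => Omega m) (fun i => ∃ k, g k = i)
  let e : {i // ∃ k, g k = i} ≃ κ := (Equiv.ofInjective g hg).symm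
  have h3 := measurePreserving_piCongrLeft (fun _ : κ => Omega m) e
  have h := h3.quasiMeasurePreserving.comp
    (Measure.quasiMeasurePreserving_fst.comp h1.quasiMeasurePreserving)
  convert h using 1
  funext ξ k
  have : k = e ⟨g k, k, rfl⟩ := (Equiv.ofInjective_symm_apply hg k).symm
  conv_rhs => rw [this]
  simp only [Function.comp_apply]
  erw [MeasurableEquiv.coe_piCongrLeft, Equiv.piCongrLeft_apply_apply]
  rfl

/-- The symmetric square-integrable functions of `N` momenta, with respect to `∏ dΩ_m(ξ_k)`. -/
def symL2 (m : ℝ) (N : ℕ) : Submodule ℂ (Lp ℂ 2 (OmegaPi m (Fin N))) where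
  carrier := {F | ∀ σ : Equiv.Perm (Fin N), ∀ᵐ ξ ∂(OmegaPi m (Fin N)), F (ξ ∘ σ) = F ξ}
  zero_mem' := by
    intro σ
    have h0 := Lp.coeFn_zero ℂ 2 (OmegaPi m (Fin N))
    filter_upwards [h0, (quasi_comp m σ σ.injective).ae h0] with ξ h1 h2
    rw [h1, h2]; rfl
  add_mem' := by
    intro F G hF hG σ
    have h0 := Lp.coeFn_add F G
    filter_upwards [h0, (quasi_comp m σ σ.injective).ae h0, hF σ, hG σ] with ξ h1 h2 h3 h4
    rw [h1, h2]; simp [h3, h4]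
  smul_mem' := by
    intro c F hF σ
    have h0 := Lp.coeFn_smul c F
    filter_upwards [h0, (quasi_comp m σ σ.injective).ae h0, hF σ] with ξ h1 h2 h3
    rw [h1, h2]; simp [h3]

/-- The Fock space `ℋ = ⊕_N ℋ_N` (Hilbert sum) over the mass hyperboloid. -/
abbrev Fock (m : ℝ) : Type := lp (fun N : ℕ => symL2 m N) 2

/-- The `N`-particle wave function of a Fock space vector. -/
def wave {m : ℝ} (Φ : Fock m) (N : ℕ) : (Fin N → Momentum) → ℂ :=
  ((Φ N : symL2 m N) : Lp ℂ 2 (OmegaPi m (Fin N)))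

lemma memLp_one (m : ℝ) : MemLp (fun _ : Fin 0 → Momentum => (1 : ℂ)) 2 (OmegaPi m (Fin 0)) := by
  rw [OmegaPi, Measure.pi_of_empty _ (fun i => i.elim0)]
  exact memLp_const 1

/-- The vacuum vector `Φ₀ = (1, 0, 0, …)`. -/
def vacuum (m : ℝ) : Fock m :=
  lp.single 2 0 ⟨(memLp_one m).toLp, fun σ => by
    have : ∀ ξ : Fin 0 → Momentum, ξ ∘ σ = ξ := fun ξ => Subsingleton.elim _ _
    simp [this]⟩

/-! ### Wick powers of the free field -/

/-- The integrand `f̃(∑ η_r - ∑_{k ∈ S} ξ_k) Φ(η₁, …, η_j, (ξ_k)_{k ∉ S})`. -/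
def wickIntegrand (m : ℝ) (f : 𝓢(Spacetime, ℂ)) (Φ : (M : ℕ) → (Fin M → Momentum) → ℂ)
    {N : ℕ} (ξ : Fin N → Momentum) (S : Finset (Fin N)) (j : ℕ) (η : Fin j → Momentum) : ℂ :=
  ftilde f (∑ r, onShell m (η r) - ∑ k ∈ S, onShell m (ξ k)) *
    Φ (j + Sᶜ.card) (Fin.append η (ξ ∘ Sᶜ.orderEmbOfFin rfl))

/-- The `N`-particle component at `(ξ₁, …, ξ_N)` of `:φ^l:(f)Φ`:
`π^{l/2} (2π)^{-2(l-1)} ∑_{j=0}^{l} [(N-l+2j)!/N!]^{1/2} ∑_{|S| = l-j} (l!/j!)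
  ∫ ∏ dΩ_m(η_r) f̃(∑ η_r - ∑_{k ∈ S} ξ_k) Φ^{(N-l+2j)}(η₁, …, η_j, (ξ_k)_{k ∉ S})`.
The factor `l!` is the sum over the permutations of the `l` variables `η_r`, `-ξ_k`. The inner sum
is empty when `N < l - j`, so the subtraction is never truncated in a term that occurs. -/
def wickValue (m : ℝ) (l : ℕ) (f : 𝓢(Spacetime, ℂ)) (Φ : (M : ℕ) → (Fin M → Momentum) → ℂ)
    (N : ℕ) (ξ : Fin N → Momentum) : ℂ :=
  ((√Real.pi ^ l / (2 * Real.pi) ^ (2 * ((l : ℤ) - 1)) : ℝ) : ℂ) *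
    ∑ j ∈ Finset.range (l + 1), ((√(((N + 2 * j - l)! : ℝ) / (N ! : ℝ)) : ℝ) : ℂ) *
      ∑ S ∈ Finset.powersetCard (l - j) (Finset.univ : Finset (Fin N)),
        ((l ! : ℂ) / (j ! : ℂ)) * ∫ η, wickIntegrand m f Φ ξ S j η ∂(OmegaPi m (Fin j))

/-- All integrals that occur in `wickValue m l f Φ N ξ` converge absolutely. -/
def WickConverges (m : ℝ) (l : ℕ) (f : 𝓢(Spacetime, ℂ)) (Φ : (M : ℕ) → (Fin M → Momentum) → ℂ)
    (N : ℕ) (ξ : Fin N → Momentum) : Prop :=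
  ∀ j ∈ Finset.range (l + 1),
    ∀ S ∈ Finset.powersetCard (l - j) (Finset.univ : Finset (Fin N)),
      Integrable (wickIntegrand m f Φ ξ S j) (OmegaPi m (Fin j))

lemma quasi_append (m : ℝ) {N j q : ℕ} (e : Fin q → Fin N) (he : Function.Injective e) :
    Measure.QuasiMeasurePreserving
      (fun p : (Fin N → Momentum) × (Fin j → Momentum) => Fin.append p.2 (p.1 ∘ e))
      ((OmegaPi m (Fin N)).prod (OmegaPi m (Fin j))) (OmegaPi m (Fin (j + q))) := by
  have h1 := (measurePreserving_sumPiEquivProdPi_symm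
    (fun _ : Fin N ⊕ Fin j => Omega m)).quasiMeasurePreserving
  let g : Fin (j + q) → Fin N ⊕ Fin j := Fin.append (fun r => Sum.inr r) (fun r => Sum.inl (e r))
  have hg : Function.Injective g := by
    intro a b
    refine Fin.addCases (fun a => ?_) (fun a => ?_) a <;>
      refine Fin.addCases (fun b => ?_) (fun b => ?_) b <;> simp [g, he.eq_iff]
  have h := (quasi_comp m g hg).comp h1
  convert h using 1
  funext p a
  refine Fin.addCases (fun a => ?_) (fun a => ?_) a
  · simp [g, MeasurableEquiv.sumPiEquivProdPi, Equiv.sumPiEquivProdPi]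
  · simp [g, MeasurableEquiv.sumPiEquivProdPi, Equiv.sumPiEquivProdPi]

lemma ae_wave {m : ℝ} {j q N : ℕ} {P : (Fin (j + q) → Momentum) → Prop}
    (h : ∀ᵐ ζ ∂(OmegaPi m (Fin (j + q))), P ζ) (e : Fin q → Fin N) (he : Function.Injective e) :
    ∀ᵐ ξ ∂(OmegaPi m (Fin N)), ∀ᵐ η ∂(OmegaPi m (Fin j)), P (Fin.append η (ξ ∘ e)) :=
  Measure.ae_ae_of_ae_prod ((quasi_append m e he).ae h)

lemma wave_add {m : ℝ} (Φ Ψ : Fock m) (N : ℕ) :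
    ∀ᵐ ξ ∂(OmegaPi m (Fin N)), wave (Φ + Ψ) N ξ = wave Φ N ξ + wave Ψ N ξ :=
  Lp.coeFn_add _ _

lemma wave_smul {m : ℝ} (c : ℂ) (Φ : Fock m) (N : ℕ) :
    ∀ᵐ ξ ∂(OmegaPi m (Fin N)), wave (c • Φ) N ξ = c * wave Φ N ξ :=
  Lp.coeFn_smul _ _

lemma wave_zero {m : ℝ} (N : ℕ) :
    ∀ᵐ ξ ∂(OmegaPi m (Fin N)), wave (0 : Fock m) N ξ = 0 :=
  Lp.coeFn_zero _ _ _

lemma wickIntegrand_ae {m : ℝ} (f : 𝓢(Spacetime, ℂ)) {Φ : (M : ℕ) → (Fin M → Momentum) → ℂ}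
    {Φ' : (M : ℕ) → (Fin M → Momentum) → ℂ}
    (h : ∀ M, ∀ᵐ ζ ∂(OmegaPi m (Fin M)), Φ M ζ = Φ' M ζ) (N : ℕ) :
    ∀ᵐ ξ ∂(OmegaPi m (Fin N)), ∀ (S : Finset (Fin N)) (j : ℕ),
      wickIntegrand m f Φ ξ S j =ᵐ[OmegaPi m (Fin j)] wickIntegrand m f Φ' ξ S j := by
  rw [ae_all_iff]; intro S
  rw [ae_all_iff]; intro j
  filter_upwards [ae_wave (h (j + Sᶜ.card)) (Sᶜ.orderEmbOfFin rfl)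
    (Sᶜ.orderEmbOfFin rfl).injective] with ξ hξ
  filter_upwards [hξ] with η hη
  simp only [wickIntegrand, hη]

lemma wick_congr {m : ℝ} {l : ℕ} {f : 𝓢(Spacetime, ℂ)} {N : ℕ} {ξ : Fin N → Momentum}
    {Φ Φ' : (M : ℕ) → (Fin M → Momentum) → ℂ}
    (h : ∀ (S : Finset (Fin N)) (j : ℕ),
      wickIntegrand m f Φ ξ S j =ᵐ[OmegaPi m (Fin j)] wickIntegrand m f Φ' ξ S j) :
    wickValue m l f Φ N ξ = wickValue m l f Φ' N ξ ∧
      (WickConverges m l f Φ N ξ ↔ WickConverges m l f Φ' N ξ) := by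
  constructor
  · simp only [wickValue, integral_congr_ae (h _ _)]
  · simp only [WickConverges, integrable_congr (h _ _)]

lemma wick_add {m : ℝ} {l : ℕ} {f : 𝓢(Spacetime, ℂ)} {N : ℕ} {ξ : Fin N → Momentum}
    {Φ Φ' : (M : ℕ) → (Fin M → Momentum) → ℂ}
    (h : WickConverges m l f Φ N ξ) (h' : WickConverges m l f Φ' N ξ) :
    WickConverges m l f (fun M ζ => Φ M ζ + Φ' M ζ) N ξ ∧
      wickValue m l f (fun M ζ => Φ M ζ + Φ' M ζ) N ξ
        = wickValue m l f Φ N ξ + wickValue m l f Φ' N ξ := by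
  have key : ∀ S j, wickIntegrand m f (fun M ζ => Φ M ζ + Φ' M ζ) ξ S j
      = fun η => wickIntegrand m f Φ ξ S j η + wickIntegrand m f Φ' ξ S j η := by
    intro S j; funext η; simp only [wickIntegrand, mul_add]
  refine ⟨fun j hj S hS => ?_, ?_⟩
  · rw [key]; exact (h j hj S hS).add (h' j hj S hS)
  · simp only [wickValue, key, ← mul_add, ← Finset.sum_add_distrib]
    congr 1
    refine Finset.sum_congr rfl fun j hj => ?_
    congr 1
    refine Finset.sum_congr rfl fun S hS => ?_
    rw [integral_add (h j hj S hS) (h' j hj S hS)]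

lemma wick_smul {m : ℝ} {l : ℕ} {f : 𝓢(Spacetime, ℂ)} {N : ℕ} {ξ : Fin N → Momentum}
    {Φ : (M : ℕ) → (Fin M → Momentum) → ℂ} (c : ℂ) (h : WickConverges m l f Φ N ξ) :
    WickConverges m l f (fun M ζ => c * Φ M ζ) N ξ ∧
      wickValue m l f (fun M ζ => c * Φ M ζ) N ξ = c * wickValue m l f Φ N ξ := by
  have key : ∀ S j, wickIntegrand m f (fun M ζ => c * Φ M ζ) ξ S j
      = fun η => c * wickIntegrand m f Φ ξ S j η := by
    intro S j; funext η; simp only [wickIntegrand]; ring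
  refine ⟨fun j hj S hS => ?_, ?_⟩
  · rw [key]; exact (h j hj S hS).const_mul c
  · simp only [wickValue, key, integral_const_mul, Finset.mul_sum]
    refine Finset.sum_congr rfl fun j hj => Finset.sum_congr rfl fun S hS => ?_
    ring

/-- The graph of `:φ^l:(f)` on its maximal domain: the pairs `(Φ, Ψ)` of Fock space vectors such
that, for every `N` and almost all `ξ`, the integrals in `wickValue` converge absolutely and
`Ψ^{(N)}(ξ)` is their value. -/
def wickGraph (m : ℝ) (l : ℕ) (f : 𝓢(Spacetime, ℂ)) : Submodule ℂ (Fock m × Fock m) where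
  carrier := {p | ∀ N, ∀ᵐ ξ ∂(OmegaPi m (Fin N)),
    WickConverges m l f (wave p.1) N ξ ∧ wave p.2 N ξ = wickValue m l f (wave p.1) N ξ}
  zero_mem' := by
    intro N
    have key : ∀ (ξ : Fin N → Momentum) S j,
        wickIntegrand m f (fun _ _ => 0) ξ S j = fun _ => 0 := by
      intro ξ S j; funext η; simp [wickIntegrand]
    filter_upwards [wave_zero (m := m) N, wickIntegrand_ae f (wave_zero (m := m)) N] with ξ h1 h2
    obtain ⟨h3, h4⟩ := wick_congr (l := l) h2
    refine ⟨h4.2 fun j _ S _ => by rw [key]; exact integrable_zero _ _ _, ?_⟩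
    refine h1.trans (Eq.trans ?_ h3.symm)
    simp [wickValue, key]
  add_mem' := by
    intro p q hp hq N
    filter_upwards [hp N, hq N, wave_add p.2 q.2 N,
      wickIntegrand_ae f (wave_add p.1 q.1) N] with ξ h1 h2 h3 h4
    obtain ⟨h5, h6⟩ := wick_congr (l := l) h4
    obtain ⟨h7, h8⟩ := wick_add h1.1 h2.1
    exact ⟨h6.2 h7, h3.trans (by rw [h1.2, h2.2, ← h8]; exact h5.symm)⟩
  smul_mem' := by
    intro c p hp N
    filter_upwards [hp N, wave_smul c p.2 N, wickIntegrand_ae f (wave_smul c p.1) N]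
      with ξ h1 h3 h4
    obtain ⟨h5, h6⟩ := wick_congr (l := l) h4
    obtain ⟨h7, h8⟩ := wick_smul c h1.1
    exact ⟨h6.2 h7, h3.trans (by rw [h1.2, ← h8]; exact h5.symm)⟩

/-- `wickGraph` is the graph of an operator. -/
lemma wickGraph_functional (m : ℝ) (l : ℕ) (f : 𝓢(Spacetime, ℂ)) (p : Fock m × Fock m)
    (hp : p ∈ wickGraph m l f) (h0 : p.1 = 0) : p.2 = 0 := by
  have hz := (wickGraph m l f).zero_mem
  ext1
  funext N
  apply Subtype.ext
  apply Lp.ext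
  filter_upwards [hp N, hz N] with ξ h1 h2
  have h3 : wave p.2 N ξ = wave (0 : Fock m) N ξ := by
    rw [h1.2, h0]; exact h2.2.symm
  exact h3

/-- The Wick power `:φ^l:(f)` of the free field `φ` of mass `m`, smeared with `f`, as an unbounded
operator in Fock space. -/
def wickPower (m : ℝ) (l : ℕ) (f : 𝓢(Spacetime, ℂ)) : Fock m →ₗ.[ℂ] Fock m :=
  (wickGraph m l f).toLinearPMap

/-! ### Products of unbounded operators, and the vacuum expectation values -/

/-- The product `AB` of unbounded operators, on `{x ∈ D(B) | Bx ∈ D(A)}`. -/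
def opMul {E : Type*} [AddCommGroup E] [Module ℂ E] (A B : E →ₗ.[ℂ] E) : E →ₗ.[ℂ] E :=
  A.comp (B.domRestrict ((A.domain.comap B.toFun).map B.domain.subtype)) (by
    rintro ⟨x, ⟨⟨y, hy⟩, h1, rfl⟩, h2⟩
    exact h1)

/-- The product `A₁ ⋯ A_n` of unbounded operators; the empty product is the identity. -/
def opProd {E : Type*} [AddCommGroup E] [Module ℂ E] {n : ℕ} (A : Fin n → E →ₗ.[ℂ] E) :
    E →ₗ.[ℂ] E :=
  (List.ofFn A).foldr opMul (LinearMap.id.toPMap ⊤)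

/-- The coefficient of `g^l` in the formal power series
`:e^{gφ}:(f) = ∑_l g^l :φ^l:(f) / l!`. -/
def wickExpCoeff (m : ℝ) (f : 𝓢(Spacetime, ℂ)) (l : ℕ) : Fock m →ₗ.[ℂ] Fock m :=
  ((l ! : ℂ)⁻¹) • wickPower m l f

/-- The coefficient of `g₁^{k₁} ⋯ g_n^{k_n}` in the formal product
`σ^{(1)}(f₁) ⋯ σ^{(n)}(f_n)`, where `σ^{(i)} = :e^{g_iφ}:`. -/
def wickExpProdCoeff (m : ℝ) {n : ℕ} (f : Fin n → 𝓢(Spacetime, ℂ)) (k : Fin n →₀ ℕ) :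
    Fock m →ₗ.[ℂ] Fock m :=
  opProd fun i => wickExpCoeff m (f i) (k i)

open Classical in
/-- The vacuum expectation value `(Φ₀, σ^{(1)}(f₁) ⋯ σ^{(n)}(f_n) Φ₀)`, as a formal power series
in `g₁, …, g_n`. (It is meaningful when `Φ₀` is in the domain of every coefficient of the
product.) -/
def vev (m : ℝ) {n : ℕ} (f : Fin n → 𝓢(Spacetime, ℂ)) : MvPowerSeries (Fin n) ℂ := fun k =>
  if h : vacuum m ∈ (wickExpProdCoeff m f k).domain then
    inner ℂ (vacuum m) (wickExpProdCoeff m f k ⟨vacuum m, h⟩)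
  else 0

/-- The formal power series `exp {∑_{i<j} g_i g_j t_{ij}}` in `g₁, …, g_n`. -/
def expSeries {n : ℕ} (t : Fin n → Fin n → ℂ) : MvPowerSeries (Fin n) ℂ :=
  (PowerSeries.exp ℂ).subst
    (∑ i : Fin n, ∑ j ∈ Finset.Ioi i,
      MvPowerSeries.X i * MvPowerSeries.X j * MvPowerSeries.C (t i j) : MvPowerSeries (Fin n) ℂ)

/-- The formal power series `exp {∑_{i<j} g_i g_j t_{ij}}` with `t_{ij} = D_m^{(-)}(z_i - z_j)` at
the points `z_i = (x_i⁰ + i y_i, 𝐱_i)` with complex times. -/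
def expTwoPoint (m : ℝ) {n : ℕ} (y : Fin n → ℝ) (x : Fin n → Spacetime) :
    MvPowerSeries (Fin n) ℂ :=
  expSeries fun i j => twoPoint m (x i - x j) (y i - y j)

end WickExp

end

noncomputable section

namespace WickExp

/-! ### Coefficients of Gaussian generating functions -/

/-- The quadratic form `∑_{i<j} t_{ij} X_i X_j`. -/
def quadForm {n : ℕ} (t : Fin n → Fin n → ℂ) : MvPolynomial (Fin n) ℂ :=
  ∑ i : Fin n, ∑ j ∈ Finset.Ioi i,
    MvPolynomial.X i * MvPolynomial.X j * MvPolynomial.C (t i j)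

/-- The coefficient of `X^k` in `exp (quadForm t) * Q`. -/
def genCoeff {n : ℕ} (t : Fin n → Fin n → ℂ) (k : Fin n →₀ ℕ) (Q : MvPolynomial (Fin n) ℂ) : ℂ :=
  ∑ d ∈ Finset.range (k.degree + 1), (d ! : ℂ)⁻¹ * MvPolynomial.coeff k (quadForm t ^ d * Q)

lemma quadForm_isHomogeneous {n : ℕ} (t : Fin n → Fin n → ℂ) : (quadForm t).IsHomogeneous 2 := by
  refine MvPolynomial.IsHomogeneous.sum _ _ _ fun i _ =>
    MvPolynomial.IsHomogeneous.sum _ _ _ fun j _ => ?_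
  simpa using ((MvPolynomial.isHomogeneous_X ℂ i).mul (MvPolynomial.isHomogeneous_X ℂ j)).mul
    (MvPolynomial.isHomogeneous_C (Fin n) (t i j))

lemma coeff_quadForm_pow_mul_eq_zero {n : ℕ} (t : Fin n → Fin n → ℂ) (k : Fin n →₀ ℕ)
    (Q : MvPolynomial (Fin n) ℂ) {d : ℕ} (hd : k.degree < d) :
    MvPolynomial.coeff k (quadForm t ^ d * Q) = 0 := by
  classical
  rw [MvPolynomial.coeff_mul]
  refine Finset.sum_eq_zero fun a ha => ?_
  have h1 : a.1.degree + a.2.degree = k.degree := by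
    rw [← map_add, Finset.HasAntidiagonal.mem_antidiagonal.1 ha]
  rw [((quadForm_isHomogeneous t).pow d).coeff_eq_zero (by omega), zero_mul]

lemma genCoeff_eq_sum_range {n : ℕ} (t : Fin n → Fin n → ℂ) (k : Fin n →₀ ℕ)
    (Q : MvPolynomial (Fin n) ℂ) {D : ℕ} (hD : k.degree < D) :
    genCoeff t k Q
      = ∑ d ∈ Finset.range D, (d ! : ℂ)⁻¹ * MvPolynomial.coeff k (quadForm t ^ d * Q) := by
  refine Finset.sum_subset (by simpa using hD) fun d _ hd => ?_
  rw [coeff_quadForm_pow_mul_eq_zero _ _ _ (by simpa [Nat.lt_succ_iff] using hd), mul_zero]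

lemma genCoeff_sum {n : ℕ} (t : Fin n → Fin n → ℂ) (k : Fin n →₀ ℕ) {ι : Type*} (s : Finset ι)
    (Q : ι → MvPolynomial (Fin n) ℂ) :
    genCoeff t k (∑ i ∈ s, Q i) = ∑ i ∈ s, genCoeff t k (Q i) := by
  simp only [genCoeff, Finset.mul_sum, MvPolynomial.coeff_sum]
  exact Finset.sum_comm

lemma genCoeff_C_mul {n : ℕ} (t : Fin n → Fin n → ℂ) (k : Fin n →₀ ℕ) (c : ℂ)
    (Q : MvPolynomial (Fin n) ℂ) :
    genCoeff t k (MvPolynomial.C c * Q) = c * genCoeff t k Q := by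
  simp only [genCoeff, Finset.mul_sum, mul_left_comm _ (MvPolynomial.C c), MvPolynomial.coeff_C_mul]
  exact Finset.sum_congr rfl fun d _ => by ring

lemma coeff_expSeries {n : ℕ} (t : Fin n → Fin n → ℂ) (k : Fin n →₀ ℕ) :
    MvPowerSeries.coeff k (expSeries t) = genCoeff t k 1 := by
  have h0 : (∑ i : Fin n, ∑ j ∈ Finset.Ioi i,
      MvPowerSeries.X i * MvPowerSeries.X j * MvPowerSeries.C (t i j) : MvPowerSeries (Fin n) ℂ)
      = (quadForm t : MvPowerSeries (Fin n) ℂ) := by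
    simp only [quadForm, ← MvPolynomial.coeToMvPowerSeries.ringHom_apply, map_sum, map_mul]
    simp
  have hs : PowerSeries.HasSubst (quadForm t : MvPowerSeries (Fin n) ℂ) := by
    apply PowerSeries.HasSubst.of_constantCoeff_zero
    rw [← h0]; simp
  rw [expSeries, h0, PowerSeries.coeff_subst hs, finsum_eq_sum_of_support_subset
    (s := Finset.range (k.degree + 1))]
  · refine Finset.sum_congr rfl fun d _ => ?_
    rw [PowerSeries.coeff_exp, ← MvPolynomial.coe_pow, MvPolynomial.coeff_coe, mul_one]
    simp
  · intro d hd
    by_contra h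
    refine hd ?_
    have := coeff_quadForm_pow_mul_eq_zero t k 1 (d := d) (by simpa [Nat.lt_succ_iff] using h)
    simp only [mul_one] at this
    simp only
    rw [← MvPolynomial.coe_pow, MvPolynomial.coeff_coe, this, smul_zero]

lemma finSuccEquiv_quadForm {n : ℕ} (t : Fin (n + 1) → Fin (n + 1) → ℂ) :
    MvPolynomial.finSuccEquiv ℂ n (quadForm t)
      = Polynomial.X * Polynomial.C (∑ a : Fin n, MvPolynomial.X a * MvPolynomial.C (t 0 a.succ))
        + Polynomial.C (quadForm fun a b => t a.succ b.succ) := by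
  have hC : ∀ c : ℂ, MvPolynomial.finSuccEquiv ℂ n (MvPolynomial.C c)
      = Polynomial.C (MvPolynomial.C c) := fun c => by simp [MvPolynomial.finSuccEquiv_apply]
  have h0 : Finset.Ioi (0 : Fin (n + 1)) = Finset.univ.map (Fin.succEmb n) := by
    ext i; simp [Fin.exists_succ_eq]
  have h1 : ∀ i : Fin n, Finset.Ioi i.succ = (Finset.Ioi i).map (Fin.succEmb n) := by
    intro i; simp
  simp only [quadForm, Fin.sum_univ_succ, map_add, map_sum, map_mul, h0, h1, Finset.sum_map,
    Fin.coe_succEmb, MvPolynomial.finSuccEquiv_X_zero, MvPolynomial.finSuccEquiv_X_succ, hC,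
    Finset.mul_sum, mul_assoc]

lemma genCoeff_cons {n : ℕ} (t : Fin (n + 1) → Fin (n + 1) → ℂ) (l : ℕ) (k : Fin n →₀ ℕ) {N : ℕ}
    (u : Fin N → ℂ) (c : Fin N → Fin n → ℂ) :
    genCoeff t (k.cons l) (∏ r, (MvPolynomial.X 0 * MvPolynomial.C (u r)
        + ∑ a, MvPolynomial.X (Fin.succ a) * MvPolynomial.C (c r a)))
      = ∑ j ∈ Finset.range (l + 1),
          ∑ S ∈ Finset.powersetCard (l - j) (Finset.univ : Finset (Fin N)),
            (j ! : ℂ)⁻¹ * (∏ r ∈ S, u r) * genCoeff (fun a b => t a.succ b.succ) k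
              ((∑ a, MvPolynomial.X a * MvPolynomial.C (t 0 a.succ)) ^ j *
                ∏ r ∈ Sᶜ, ∑ a, MvPolynomial.X a * MvPolynomial.C (c r a)) := by
  have hC : ∀ c : ℂ, MvPolynomial.finSuccEquiv ℂ n (MvPolynomial.C c)
      = Polynomial.C (MvPolynomial.C c) := fun c => by simp [MvPolynomial.finSuccEquiv_apply]
  set T : MvPolynomial (Fin n) ℂ := ∑ a, MvPolynomial.X a * MvPolynomial.C (t 0 a.succ) with hT
  set B := quadForm fun a b => t a.succ b.succ with hB
  set h : Fin N → MvPolynomial (Fin n) ℂ :=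
    fun r => ∑ a, MvPolynomial.X a * MvPolynomial.C (c r a) with hh
  have hdeg : (k.cons l).degree = l + k.degree := by
    simp [Finsupp.degree_eq_sum, Fin.sum_univ_succ]
  have hprod : MvPolynomial.finSuccEquiv ℂ n (∏ r, (MvPolynomial.X 0 * MvPolynomial.C (u r)
        + ∑ a, MvPolynomial.X (Fin.succ a) * MvPolynomial.C (c r a)))
      = ∑ S : Finset (Fin N), Polynomial.X ^ S.card *
          Polynomial.C (MvPolynomial.C (∏ r ∈ S, u r) * ∏ r ∈ Sᶜ, h r) := by
    simp only [map_prod, map_add, map_sum, map_mul, MvPolynomial.finSuccEquiv_X_zero,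
      MvPolynomial.finSuccEquiv_X_succ, hC, hh]
    rw [Fintype.prod_add]
    refine Finset.sum_congr rfl fun S _ => ?_
    rw [Finset.prod_mul_distrib, Finset.prod_const, mul_assoc]
  have hpow : ∀ d, Polynomial.C (MvPolynomial.C (d ! : ℂ)⁻¹) *
      (MvPolynomial.finSuccEquiv ℂ n (quadForm t)) ^ d
      = ∑ p ∈ Finset.range (d + 1), Polynomial.X ^ p *
        Polynomial.C (MvPolynomial.C ((p ! : ℂ)⁻¹ * ((d - p)! : ℂ)⁻¹) * T ^ p * B ^ (d - p)) := by
    intro d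
    rw [finSuccEquiv_quadForm, add_pow, Finset.mul_sum]
    refine Finset.sum_congr rfl fun p hp => ?_
    have hp' : p ≤ d := by simpa [Nat.lt_succ_iff] using hp
    have h1 : (p ! : ℂ)⁻¹ * ((d - p)! : ℂ)⁻¹ = (d ! : ℂ)⁻¹ * (d.choose p : ℂ) := by
      rw [Nat.cast_choose ℂ hp']
      have : (d ! : ℂ) ≠ 0 := by exact_mod_cast d.factorial_ne_zero
      field_simp
    rw [h1]
    simp only [mul_pow, map_mul, map_pow, map_natCast]
    ring
  have hcoef : ∀ d, (d ! : ℂ)⁻¹ * MvPolynomial.coeff (k.cons l) (quadForm t ^ d *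
        ∏ r, (MvPolynomial.X 0 * MvPolynomial.C (u r)
        + ∑ a, MvPolynomial.X (Fin.succ a) * MvPolynomial.C (c r a)))
      = ∑ p ∈ Finset.range (d + 1), ∑ S : Finset (Fin N), if p + S.card = l then
          (p ! : ℂ)⁻¹ * (∏ r ∈ S, u r) * (((d - p)! : ℂ)⁻¹ * MvPolynomial.coeff k
            (B ^ (d - p) * (T ^ p * ∏ r ∈ Sᶜ, h r))) else 0 := by
    intro d
    rw [← MvPolynomial.coeff_C_mul, ← MvPolynomial.finSuccEquiv_coeff_coeff, map_mul, map_mul,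
      map_pow, hC, ← mul_assoc, hpow, hprod, Finset.sum_mul, Polynomial.finsetSum_coeff,
      MvPolynomial.coeff_sum]
    refine Finset.sum_congr rfl fun p _ => ?_
    rw [Finset.mul_sum, Polynomial.finsetSum_coeff, MvPolynomial.coeff_sum]
    refine Finset.sum_congr rfl fun S _ => ?_
    have : Polynomial.X ^ p * Polynomial.C (MvPolynomial.C ((p ! : ℂ)⁻¹ * ((d - p)! : ℂ)⁻¹)
          * T ^ p * B ^ (d - p)) * (Polynomial.X ^ S.card *
          Polynomial.C (MvPolynomial.C (∏ r ∈ S, u r) * ∏ r ∈ Sᶜ, h r))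
        = Polynomial.C (MvPolynomial.C ((p ! : ℂ)⁻¹ * (∏ r ∈ S, u r) * ((d - p)! : ℂ)⁻¹) *
            (B ^ (d - p) * (T ^ p * ∏ r ∈ Sᶜ, h r))) * Polynomial.X ^ (p + S.card) := by
      simp only [map_mul, map_pow, pow_add]
      ring
    rw [this, Polynomial.coeff_C_mul, Polynomial.coeff_X_pow]
    by_cases hl : p + S.card = l
    · rw [if_pos hl.symm, if_pos hl, mul_one, MvPolynomial.coeff_C_mul]; ring
    · rw [if_neg (Ne.symm hl), if_neg hl, mul_zero, MvPolynomial.coeff_zero]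
  rw [genCoeff_eq_sum_range _ _ _ (D := l + k.degree + 1) (by omega)]
  simp only [hcoef]
  rw [Finset.sum_range_diag_flip (l + k.degree + 1) fun p q => ∑ S : Finset (Fin N),
    if p + S.card = l then (p ! : ℂ)⁻¹ * (∏ r ∈ S, u r) * ((q ! : ℂ)⁻¹ * MvPolynomial.coeff k
            (B ^ q * (T ^ p * ∏ r ∈ Sᶜ, h r))) else 0]
  symm
  refine Eq.trans ?_ (Finset.sum_subset (s₁ := Finset.range (l + 1)) (by
    intro x; simp only [Finset.mem_range]; omega) ?_)
  · refine Finset.sum_congr rfl fun p hp => ?_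
    have hp' : p ≤ l := by simpa [Nat.lt_succ_iff] using hp
    rw [Finset.sum_comm]
    have : Finset.powersetCard (l - p) (Finset.univ : Finset (Fin N))
        = Finset.univ.filter fun S => p + S.card = l := by
      ext S; simp only [Finset.mem_powersetCard, Finset.subset_univ, true_and,
        Finset.mem_filter, Finset.mem_univ]; omega
    rw [this, Finset.sum_filter]
    refine Finset.sum_congr rfl fun S _ => ?_
    by_cases hl : p + S.card = l
    · simp only [if_pos hl]
      rw [← Finset.mul_sum, genCoeff_eq_sum_range _ _ _ (D := l + k.degree + 1 - p) (by omega)]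
    · simp [hl]
  · intro p _ hp
    refine Finset.sum_eq_zero fun q _ => Finset.sum_eq_zero fun S _ => if_neg ?_
    simp only [Finset.mem_range] at hp
    omega

/-! ### Kinematic estimates -/

lemma continuous_energy (m : ℝ) : Continuous (energy m) := by
  unfold energy; fun_prop

lemma energy_nonneg (m : ℝ) (p : Momentum) : 0 ≤ energy m p := Real.sqrt_nonneg _

lemma norm_le_energy (m : ℝ) (p : Momentum) : ‖p‖ ≤ energy m p :=
  Real.le_sqrt_of_sq_le (by nlinarith [sq_nonneg m])

lemma continuous_onShell (m : ℝ) : Continuous (onShell m) := by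
  unfold onShell
  refine (PiLp.continuous_toLp 2 _).comp (continuous_pi fun i => ?_)
  have := continuous_energy m
  fin_cases i <;> simp <;> fun_prop

lemma onShell_zero_coord (m : ℝ) (p : Momentum) : onShell m p 0 = energy m p := rfl

lemma norm_le_norm_sum_onShell (m : ℝ) {ι : Type*} (S : Finset ι) (ξ : ι → Momentum) {k : ι}
    (hk : k ∈ S) : ‖ξ k‖ ≤ ‖∑ k ∈ S, onShell m (ξ k)‖ := by
  refine le_trans ?_ (PiLp.norm_apply_le (∑ k ∈ S, onShell m (ξ k)) 0)
  have h : (∑ k ∈ S, onShell m (ξ k)) 0 = ∑ k ∈ S, energy m (ξ k) := by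
    simp [onShell_zero_coord]
  rw [h, Real.norm_of_nonneg (Finset.sum_nonneg fun k _ => energy_nonneg m _)]
  exact (norm_le_energy m (ξ k)).trans
    (Finset.single_le_sum (f := fun k => energy m (ξ k)) (fun k _ => energy_nonneg m _) hk)

lemma one_add_norm_onShell_le {m : ℝ} (hm : 0 ≤ m) (p : Momentum) :
    1 + ‖onShell m p‖ ≤ (2 + m) * (1 + ‖p‖) := by
  have h : ‖onShell m p‖ ≤ 2 * ‖p‖ + m := by
    refine abs_le_of_sq_le_sq' ?_ (by positivity) |>.2
    rw [EuclideanSpace.norm_sq_eq, Fin.sum_univ_four]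
    have h3 : ‖p‖ ^ 2 = p 0 ^ 2 + p 1 ^ 2 + p 2 ^ 2 := by
      rw [EuclideanSpace.norm_sq_eq, Fin.sum_univ_three]; simp
    have h0 : energy m p ^ 2 = ‖p‖ ^ 2 + m ^ 2 := Real.sq_sqrt (by positivity)
    simp only [onShell, Real.norm_eq_abs, sq_abs]
    simp
    nlinarith [norm_nonneg p, mul_nonneg hm (norm_nonneg p)]
  nlinarith [norm_nonneg p, mul_nonneg hm (norm_nonneg p)]

lemma mink_zero_left (x : Spacetime) : mink 0 x = 0 := by simp [mink]

lemma mink_add_left (p q x : Spacetime) : mink (p + q) x = mink p x + mink q x := by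
  simp [mink]; ring

lemma mink_sub_left (p q x : Spacetime) : mink (p - q) x = mink p x - mink q x := by
  simp [mink]; ring

lemma mink_sub_right (p x y : Spacetime) : mink p (x - y) = mink p x - mink p y := by
  simp [mink]; ring

lemma mink_sum_left {ι : Type*} (S : Finset ι) (p : ι → Spacetime) (x : Spacetime) :
    mink (∑ i ∈ S, p i) x = ∑ i ∈ S, mink (p i) x := by
  classical
  induction S using Finset.induction_on with
  | empty => simp [mink_zero_left]
  | insert a S ha ih => rw [Finset.sum_insert ha, Finset.sum_insert ha, mink_add_left, ih]

lemma continuous_mink : Continuous fun q : Spacetime × Spacetime => mink q.1 q.2 := by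
  unfold mink; fun_prop

lemma Continuous.mink {X : Type*} [TopologicalSpace X] {p x : X → Spacetime} (hp : Continuous p)
    (hx : Continuous x) : Continuous fun z => mink (p z) (x z) :=
  continuous_mink.comp (hp.prodMk hx)

/-! ### The Fourier transform -/

/-- The Euclidean covector `(p⁰, -p¹, -p², -p³) / 2π`. -/
def freq (p : Spacetime) : Spacetime :=
  (2 * Real.pi)⁻¹ • !₂[p 0, -p 1, -p 2, -p 3]

lemma norm_freq (p : Spacetime) : ‖freq p‖ = (2 * Real.pi)⁻¹ * ‖p‖ := by
  rw [freq, norm_smul, Real.norm_of_nonneg (by positivity)]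
  congr 1
  rw [EuclideanSpace.norm_eq, EuclideanSpace.norm_eq, Fin.sum_univ_four, Fin.sum_univ_four]
  simp

lemma continuous_freq : Continuous freq := by
  unfold freq
  have h : Continuous fun p : Spacetime => ![p 0, -p 1, -p 2, -p 3] := by
    refine continuous_pi fun i => ?_
    fin_cases i <;> simp <;> fun_prop
  have h' : Continuous fun p : Spacetime => (!₂[p 0, -p 1, -p 2, -p 3] : Spacetime) :=
    (PiLp.continuous_toLp 2 _).comp h
  exact h'.const_smul (2 * Real.pi)⁻¹

lemma ftilde_eq_fourier (f : 𝓢(Spacetime, ℂ)) (p : Spacetime) :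
    ftilde f p = ((2 * Real.pi : ℝ) : ℂ)⁻¹ ^ 2 *
      (FourierTransform.fourier f : 𝓢(Spacetime, ℂ)) (freq p) := by
  rw [ftilde, SchwartzMap.fourier_coe, Real.fourier_eq']
  congr 1
  refine integral_congr_ae (ae_of_all _ fun x => ?_)
  simp only [smul_eq_mul]
  congr 2
  have : inner ℝ x (freq p) = (2 * Real.pi)⁻¹ * mink p x := by
    simp [freq, mink, PiLp.inner_apply, Fin.sum_univ_four]; ring
  rw [this]
  have h2 : -2 * Real.pi * ((2 * Real.pi)⁻¹ * mink p x) = - mink p x := by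
    field_simp
  rw [h2]; push_cast; ring

lemma continuous_ftilde (f : 𝓢(Spacetime, ℂ)) : Continuous (ftilde f) := by
  have : ftilde f = fun p => ((2 * Real.pi : ℝ) : ℂ)⁻¹ ^ 2 *
      (FourierTransform.fourier f : 𝓢(Spacetime, ℂ)) (freq p) := funext (ftilde_eq_fourier f)
  rw [this]
  exact continuous_const.mul ((SchwartzMap.continuous _).comp continuous_freq)

lemma ftilde_decay (f : 𝓢(Spacetime, ℂ)) (r : ℕ) :
    ∃ C, 0 ≤ C ∧ ∀ p, (1 + ‖p‖) ^ r * ‖ftilde f p‖ ≤ C := by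
  obtain ⟨C, hC⟩ : ∃ C, ∀ w, (1 + ‖w‖) ^ r *
      ‖(FourierTransform.fourier f : 𝓢(Spacetime, ℂ)) w‖ ≤ C := by
    have h := fun w => SchwartzMap.one_add_le_sup_seminorm_apply (𝕜 := ℂ) (m := (r, 0)) le_rfl
      le_rfl (FourierTransform.fourier f : 𝓢(Spacetime, ℂ)) w
    simp only [norm_iteratedFDeriv_zero] at h
    exact ⟨_, h⟩
  have hC0 : 0 ≤ C := le_trans (by positivity) (hC 0)
  refine ⟨(2 * Real.pi) ^ r * (‖((2 * Real.pi : ℝ) : ℂ)⁻¹ ^ 2‖ * C), by positivity, fun p => ?_⟩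
  have h1 : 1 + ‖p‖ ≤ 2 * Real.pi * (1 + ‖freq p‖) := by
    rw [norm_freq, mul_add, ← mul_assoc, mul_inv_cancel₀ (by positivity), one_mul]
    nlinarith [Real.pi_gt_three]
  calc (1 + ‖p‖) ^ r * ‖ftilde f p‖
      ≤ (2 * Real.pi * (1 + ‖freq p‖)) ^ r * ‖ftilde f p‖ := by gcongr
    _ = (2 * Real.pi) ^ r * (‖((2 * Real.pi : ℝ) : ℂ)⁻¹ ^ 2‖ * ((1 + ‖freq p‖) ^ r *
          ‖(FourierTransform.fourier f : 𝓢(Spacetime, ℂ)) (freq p)‖)) := by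
        rw [ftilde_eq_fourier, norm_mul, mul_pow]; ring
    _ ≤ _ := by gcongr; exact hC _

/-! ### Integration over the mass hyperboloid -/

lemma measurable_density (m : ℝ) : Measurable fun p => ENNReal.ofReal (1 / energy m p) :=
  (measurable_const.div (continuous_energy m).measurable).ennreal_ofReal

lemma integrable_Omega_of_bound (m : ℝ) {C : ℝ} {g : Momentum → ℝ} (hg : Continuous g)
    (h : ∀ p, (1 + ‖p‖) ^ 4 * |g p| ≤ C) : Integrable g (Omega m) := by
  have hC : 0 ≤ C := le_trans (by positivity) (h 0)
  have h1 : Integrable (fun p : Momentum => (fun y : ℝ => C * (y⁻¹ * ((1 + y) ^ 4)⁻¹)) ‖p‖) := by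
    rw [integrable_fun_norm_addHaar (μ := volume) (f := fun y : ℝ => C * (y⁻¹ * ((1 + y) ^ 4)⁻¹))]
    refine Integrable.mono' (g := fun y : ℝ => C * (1 + ‖y‖) ^ (-3 : ℝ)) ?_ ?_ ?_
    · exact ((integrable_one_add_norm (by simp)).const_mul C).integrableOn
    · exact Measurable.aestronglyMeasurable (by fun_prop)
    · filter_upwards [ae_restrict_mem measurableSet_Ioi] with y hy
      have hy' : 0 < y := hy
      have : (1 + y) ^ (-3 : ℝ) = ((1 + y) ^ 3)⁻¹ := by
        rw [Real.rpow_neg (by positivity)]; norm_cast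
      simp only [finrank_euclideanSpace, Fintype.card_fin, smul_eq_mul]
      rw [Real.norm_of_nonneg (by positivity), Real.norm_of_nonneg hy'.le, this]
      have e : y ^ (3 - 1) * (C * (y⁻¹ * ((1 + y) ^ 4)⁻¹)) = C * (y * ((1 + y) ^ 4)⁻¹) := by
        norm_num
        field_simp
      rw [e]
      gcongr
      rw [← div_eq_mul_inv, div_le_iff₀ (by positivity)]
      field_simp
      nlinarith
  rw [Omega, integrable_withDensity_iff_integrable_smul' (measurable_density m)
    (ae_of_all _ fun _ => ENNReal.ofReal_lt_top)]
  refine h1.mono' ?_ ?_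
  · exact ((measurable_density m).ennreal_toReal.smul hg.measurable).aestronglyMeasurable
  · filter_upwards [compl_mem_ae_iff.2 (measure_singleton (0 : Momentum))] with p hp
    have h0 : 0 < ‖p‖ := norm_pos_iff.2 hp
    have h2 := energy_nonneg m p
    rw [norm_smul, ENNReal.toReal_ofReal (by positivity), Real.norm_of_nonneg (by positivity),
      Real.norm_eq_abs]
    have h3 : |g p| ≤ C * ((1 + ‖p‖) ^ 4)⁻¹ := by
      rw [← div_eq_mul_inv, le_div_iff₀ (by positivity), mul_comm]; exact h p
    have h4 : 1 / energy m p ≤ ‖p‖⁻¹ := by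
      rw [one_div]
      exact inv_anti₀ h0 (norm_le_energy m p)
    calc 1 / energy m p * |g p| ≤ ‖p‖⁻¹ * (C * ((1 + ‖p‖) ^ 4)⁻¹) := by gcongr
      _ = _ := by ring

lemma integrable_exp_neg_energy (m : ℝ) {δ : ℝ} (hδ : 0 < δ) :
    Integrable (fun p => Real.exp (-(δ * energy m p))) (Omega m) := by
  obtain ⟨C, hC⟩ : ∃ C, ∀ x : ℝ, 0 ≤ x → (1 + x) ^ 4 * Real.exp (-(δ * x)) ≤ C := by
    refine ⟨(1 + δ⁻¹) ^ 4 * 4 ! * Real.exp 1, fun x hx => ?_⟩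
    have h1 : (1 + δ * x) ^ 4 ≤ 4 ! * Real.exp (1 + δ * x) := by
      have := Real.pow_div_factorial_le_exp (1 + δ * x) (by positivity) 4
      rw [div_le_iff₀ (by positivity)] at this
      linarith
    have h2 : 1 + x ≤ (1 + δ⁻¹) * (1 + δ * x) := by
      have : δ⁻¹ * (δ * x) = x := by field_simp
      have h3 : 0 < δ⁻¹ := by positivity
      nlinarith [mul_nonneg hδ.le hx]
    calc (1 + x) ^ 4 * Real.exp (-(δ * x))
        ≤ ((1 + δ⁻¹) * (1 + δ * x)) ^ 4 * Real.exp (-(δ * x)) := by gcongr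
      _ = (1 + δ⁻¹) ^ 4 * (1 + δ * x) ^ 4 * Real.exp (-(δ * x)) := by ring
      _ ≤ (1 + δ⁻¹) ^ 4 * (4 ! * Real.exp (1 + δ * x)) * Real.exp (-(δ * x)) := by gcongr
      _ = (1 + δ⁻¹) ^ 4 * 4 ! * (Real.exp (1 + δ * x) * Real.exp (-(δ * x))) := by ring
      _ = _ := by rw [← Real.exp_add]; ring_nf
  have := continuous_energy m
  refine integrable_Omega_of_bound m (C := C) (by fun_prop) fun p => ?_
  rw [abs_of_nonneg (Real.exp_pos _).le]
  refine le_trans ?_ (hC ‖p‖ (norm_nonneg p))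
  gcongr
  exact norm_le_energy m p

lemma integral_Omega (m : ℝ) (g : Momentum → ℂ) :
    ∫ p, g p ∂(Omega m) = ∫ p, ((energy m p : ℝ) : ℂ)⁻¹ * g p := by
  rw [Omega, integral_withDensity_eq_integral_toReal_smul (measurable_density m)
    (ae_of_all _ fun _ => ENNReal.ofReal_lt_top)]
  refine integral_congr_ae (ae_of_all _ fun p => ?_)
  have h2 := energy_nonneg m p
  simp only
  rw [ENNReal.toReal_ofReal (by positivity), Complex.real_smul, one_div, Complex.ofReal_inv]

/-- The rate of decay of the wave functions, `∏ (1 + |ζ_i|)`. -/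
def weight {N : ℕ} (ζ : Fin N → Momentum) : ℝ := ∏ i, (1 + ‖ζ i‖)

lemma one_le_weight {N : ℕ} (ζ : Fin N → Momentum) : 1 ≤ weight ζ :=
  Finset.one_le_prod fun i => by simp

lemma weight_pos {N : ℕ} (ζ : Fin N → Momentum) : 0 < weight ζ :=
  zero_lt_one.trans_le (one_le_weight ζ)

lemma integrable_weight (m : ℝ) (N : ℕ) :
    Integrable (fun ζ => (weight ζ ^ 4)⁻¹) (OmegaPi m (Fin N)) := by
  have h : ∀ p : Momentum, (1 + ‖p‖) ^ 4 ≠ 0 := fun p => by positivity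
  have h1 : Integrable (fun p => ((1 + ‖p‖) ^ 4)⁻¹) (Omega m) := by
    refine integrable_Omega_of_bound m (C := 1) (Continuous.inv₀ (by fun_prop) h) fun p => ?_
    rw [abs_of_nonneg (by positivity), mul_inv_cancel₀ (h p)]
  have := Integrable.fintype_prod (μ := fun _ : Fin N => Omega m)
    (f := fun (_ : Fin N) p => ((1 + ‖p‖) ^ 4)⁻¹) fun _ => h1
  refine this.congr (ae_of_all _ fun ζ => ?_)
  simp only [weight, ← Finset.prod_pow, Finset.prod_inv_distrib]

/-! ### Rapidly decreasing states -/

/-- A family of states with finitely many particles, whose wave functions are symmetric, jointly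
continuous, and rapidly decreasing uniformly in the parameter. -/
structure RapidFamily {A : Type} [TopologicalSpace A]
    (Φ : A → (M : ℕ) → (Fin M → Momentum) → ℂ) : Prop where
  finite : ∃ M₀, ∀ a, ∀ M > M₀, ∀ ζ, Φ a M ζ = 0
  cont : ∀ M, Continuous fun q : A × (Fin M → Momentum) => Φ q.1 M q.2
  decay : ∀ M r, ∃ C, ∀ a ζ, weight ζ ^ r * ‖Φ a M ζ‖ ≤ C
  symm : ∀ a M (σ : Equiv.Perm (Fin M)) ζ, Φ a M (ζ ∘ σ) = Φ a M ζ

/-- The wave functions of the vacuum. -/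
def vacFn (M : ℕ) (_ : Fin M → Momentum) : ℂ := if M = 0 then 1 else 0

/-- The wave functions of `e^{-|s|H} Φ`, where `H` is the energy. -/
def damp (m s : ℝ) (Φ : (M : ℕ) → (Fin M → Momentum) → ℂ) (M : ℕ) (ζ : Fin M → Momentum) : ℂ :=
  (Real.exp (-(|s| * ∑ i, energy m (ζ i))) : ℂ) * Φ M ζ

lemma rapidFamily_vacFn {A : Type} [TopologicalSpace A] : RapidFamily fun _ : A => vacFn where
  finite := ⟨0, fun a M hM ζ => if_neg (by omega)⟩
  cont M := continuous_const
  decay M r := by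
    rcases eq_or_ne M 0 with rfl | hM
    · exact ⟨1, fun _ ζ => by simp [vacFn, weight]⟩
    · exact ⟨0, fun _ ζ => by simp [vacFn, hM]⟩
  symm _ _ _ _ := rfl

section

variable {A : Type} [TopologicalSpace A] {Φ : A → (M : ℕ) → (Fin M → Momentum) → ℂ}

lemma RapidFamily.comp {A' : Type} [TopologicalSpace A'] (h : RapidFamily Φ) {g : A' → A}
    (hg : Continuous g) : RapidFamily fun a => Φ (g a) where
  finite := h.finite.imp fun _ h a => h (g a)
  cont M := (h.cont M).comp ((hg.comp continuous_fst).prodMk continuous_snd)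
  decay M r := (h.decay M r).imp fun _ h a => h (g a)
  symm a := h.symm (g a)

lemma RapidFamily.damp (m : ℝ) (h : RapidFamily Φ) {s : A → ℝ} (hs : Continuous s) :
    RapidFamily fun a => damp m (s a) (Φ a) where
  finite := h.finite.imp fun _ h a M hM ζ => by simp [WickExp.damp, h a M hM ζ]
  cont M := by
    have h1 := continuous_energy m
    have h2 := h.cont M
    unfold WickExp.damp
    fun_prop
  decay M r := by
    obtain ⟨C, hC⟩ := h.decay M r
    refine ⟨C, fun a ζ => le_trans ?_ (hC a ζ)⟩
    have h0 : 0 ≤ |s a| * ∑ i, energy m (ζ i) :=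
      mul_nonneg (abs_nonneg _) (Finset.sum_nonneg fun i _ => energy_nonneg m _)
    have hw := weight_pos ζ
    rw [WickExp.damp, norm_mul, Complex.norm_real, Real.norm_of_nonneg (Real.exp_pos _).le]
    gcongr
    exact mul_le_of_le_one_left (norm_nonneg _) (Real.exp_le_one_iff.2 (by linarith))
  symm a M σ ζ := by
    simp only [WickExp.damp, h.symm a M σ ζ, Function.comp_apply]
    rw [Equiv.sum_comp σ fun i => energy m (ζ i)]

lemma RapidFamily.apply_eq_of_equiv (h : RapidFamily Φ) (a : A) {M M' : ℕ} (e : Fin M ≃ Fin M')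
    (ζ : Fin M → Momentum) (ζ' : Fin M' → Momentum) (hζ : ∀ i, ζ i = ζ' (e i)) :
    Φ a M ζ = Φ a M' ζ' := by
  obtain rfl : M = M' := by simpa using Fintype.card_congr e
  rw [← h.symm a M e ζ']
  congr 1
  funext i
  exact hζ i

lemma weight_append {j q : ℕ} (η : Fin j → Momentum) (ξ : Fin q → Momentum) :
    weight (Fin.append η ξ) = weight η * weight ξ := by
  simp [weight, Fin.prod_univ_add]

lemma weight_eq_mul {N : ℕ} (ξ : Fin N → Momentum) (S : Finset (Fin N)) :
    weight ξ = (∏ k ∈ S, (1 + ‖ξ k‖)) * weight (ξ ∘ Sᶜ.orderEmbOfFin rfl) := by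
  rw [weight, ← Finset.prod_mul_prod_compl S, weight]
  congr 1
  rw [← Finset.prod_coe_sort, ← (Sᶜ.orderIsoOfFin rfl).toEquiv.prod_comp]
  rfl

lemma prod_one_add_norm_le {m : ℝ} (hm : 0 ≤ m) {N j : ℕ} (ξ : Fin N → Momentum)
    (S : Finset (Fin N)) (η : Fin j → Momentum) :
    ∏ k ∈ S, (1 + ‖ξ k‖) ≤
      ((1 + ‖∑ r, onShell m (η r) - ∑ k ∈ S, onShell m (ξ k)‖) *
        ((2 + m) ^ j * weight η)) ^ S.card := by
  set P := ∑ r, onShell m (η r) with hP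
  set Q := ∑ k ∈ S, onShell m (ξ k) with hQ
  have h1 : 1 + ‖P‖ ≤ (2 + m) ^ j * weight η := by
    have : ∀ T : Finset (Fin j), 1 + ‖∑ r ∈ T, onShell m (η r)‖
        ≤ ∏ r ∈ T, (1 + ‖onShell m (η r)‖) := by
      intro T
      induction T using Finset.induction_on with
      | empty => simp
      | insert a T ha ih =>
        rw [Finset.sum_insert ha, Finset.prod_insert ha]
        have := norm_add_le (onShell m (η a)) (∑ r ∈ T, onShell m (η r))
        nlinarith [norm_nonneg (onShell m (η a)), norm_nonneg (∑ r ∈ T, onShell m (η r))]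
    refine (this Finset.univ).trans ?_
    refine (Finset.prod_le_prod (fun _ _ => by positivity)
      fun r _ => one_add_norm_onShell_le hm (η r)).trans ?_
    simp [Finset.prod_mul_distrib, weight]
  have h2 : 1 + ‖Q‖ ≤ (1 + ‖P - Q‖) * (1 + ‖P‖) := by
    have : ‖Q‖ ≤ ‖P - Q‖ + ‖P‖ := by
      have := norm_sub_le P (P - Q)
      rw [sub_sub_cancel] at this
      linarith
    nlinarith [norm_nonneg (P - Q), norm_nonneg P]
  rw [← Finset.prod_const]
  refine Finset.prod_le_prod (fun _ _ => by positivity) fun k hk => ?_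
  have h3 : 1 + ‖ξ k‖ ≤ 1 + ‖Q‖ := by
    gcongr; exact norm_le_norm_sum_onShell m S ξ hk
  refine h3.trans (h2.trans ?_)
  gcongr

lemma RapidFamily.wickIntegrand_bound {m : ℝ} (hm : 0 ≤ m) (h : RapidFamily Φ)
    (f : 𝓢(Spacetime, ℂ)) {N : ℕ} (S : Finset (Fin N)) (j r : ℕ) :
    ∃ C, ∀ a ξ η, weight ξ ^ r * ‖wickIntegrand m f (Φ a) ξ S j η‖ ≤ C * (weight η ^ 4)⁻¹ := by
  obtain ⟨C₁, hC₁⟩ := h.decay (j + Sᶜ.card) (S.card * r + r + 4)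
  obtain ⟨C₂, h0, hC₂⟩ := ftilde_decay f (S.card * r)
  refine ⟨((2 + m) ^ j) ^ (S.card * r) * (C₂ * C₁), fun a ξ η => ?_⟩
  set p := ∑ r, onShell m (η r) - ∑ k ∈ S, onShell m (ξ k) with hp
  set ξ' := ξ ∘ Sᶜ.orderEmbOfFin rfl with hξ'
  have hw := one_le_weight η
  have hw' := one_le_weight ξ'
  have hw0 := weight_pos η
  have hw0' := weight_pos ξ'
  rw [← div_eq_mul_inv, le_div_iff₀ (by positivity), wickIntegrand, norm_mul]
  have h1 : weight ξ ^ r ≤ ((1 + ‖p‖) * ((2 + m) ^ j * weight η)) ^ (S.card * r)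
      * weight ξ' ^ r := by
    rw [weight_eq_mul ξ S, mul_pow, pow_mul]
    have h0 : 0 ≤ ∏ k ∈ S, (1 + ‖ξ k‖) := Finset.prod_nonneg fun _ _ => by positivity
    gcongr
    exact prod_one_add_norm_le hm ξ S η
  have h2 : weight η ^ (S.card * r + 4) * weight ξ' ^ r
      ≤ weight (Fin.append η ξ') ^ (S.card * r + r + 4) := by
    rw [weight_append, mul_pow]
    gcongr <;> first | assumption | omega
  set F := ‖ftilde f p‖
  set G := ‖Φ a (j + Sᶜ.card) (Fin.append η ξ')‖
  have hF : 0 ≤ F := norm_nonneg _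
  have hG : 0 ≤ G := norm_nonneg _
  calc weight ξ ^ r * (F * G) * weight η ^ 4
      ≤ ((1 + ‖p‖) * ((2 + m) ^ j * weight η)) ^ (S.card * r)
          * weight ξ' ^ r * (F * G) * weight η ^ 4 := by gcongr
    _ = ((2 + m) ^ j) ^ (S.card * r) * (((1 + ‖p‖) ^ (S.card * r) * F) *
          ((weight η ^ (S.card * r + 4) * weight ξ' ^ r) * G)) := by
        rw [mul_pow, mul_pow, pow_add]; ring
    _ ≤ ((2 + m) ^ j) ^ (S.card * r) * (C₂ * C₁) := by
        gcongr
        · exact hC₂ p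
        · exact le_trans (by gcongr) (hC₁ a (Fin.append η ξ'))

lemma continuous_append {X : Type*} [TopologicalSpace X] {j q : ℕ} {g : X → Fin j → Momentum}
    {h : X → Fin q → Momentum} (hg : Continuous g) (hh : Continuous h) :
    Continuous fun x => Fin.append (g x) (h x) := by
  refine continuous_pi fun i => ?_
  refine Fin.addCases (fun i => ?_) (fun i => ?_) i
  · simpa [Function.comp_def] using (continuous_apply i).comp hg
  · simpa [Function.comp_def] using (continuous_apply i).comp hh

lemma RapidFamily.continuous_wickIntegrand {m : ℝ} (h : RapidFamily Φ)
    (f : 𝓢(Spacetime, ℂ)) {N : ℕ} (S : Finset (Fin N)) (j : ℕ) :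
    Continuous fun q : (A × (Fin N → Momentum)) × (Fin j → Momentum) =>
      wickIntegrand m f (Φ q.1.1) q.1.2 S j q.2 := by
  have h1 := continuous_onShell m
  unfold wickIntegrand
  refine ((continuous_ftilde f).comp (by fun_prop)).mul ?_
  refine (h.cont (j + Sᶜ.card)).comp (Continuous.prodMk (by fun_prop) ?_)
  exact continuous_append (by fun_prop)
    (continuous_pi fun i => (continuous_apply _).comp (by fun_prop))

lemma RapidFamily.integrable_wickIntegrand {m : ℝ} (hm : 0 ≤ m) (h : RapidFamily Φ)
    (f : 𝓢(Spacetime, ℂ)) {N : ℕ} (S : Finset (Fin N)) (j : ℕ) (a : A) (ξ : Fin N → Momentum) :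
    Integrable (wickIntegrand m f (Φ a) ξ S j) (OmegaPi m (Fin j)) := by
  obtain ⟨C, hC⟩ := h.wickIntegrand_bound hm f S j 0
  refine ((integrable_weight m j).const_mul C).mono' ?_ (ae_of_all _ fun η => ?_)
  · exact ((h.continuous_wickIntegrand f S j).comp
      (Continuous.prodMk_right (a, ξ))).aestronglyMeasurable
  · simpa using hC a ξ η

lemma RapidFamily.wickIntegrand_comp_perm {m : ℝ} (h : RapidFamily Φ) (f : 𝓢(Spacetime, ℂ))
    {N : ℕ} (σ : Equiv.Perm (Fin N)) (S : Finset (Fin N)) (j : ℕ) (a : A) (ξ : Fin N → Momentum)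
    (η : Fin j → Momentum) :
    wickIntegrand m f (Φ a) (ξ ∘ σ) S j η
      = wickIntegrand m f (Φ a) ξ (S.map σ.toEmbedding) j η := by
  unfold wickIntegrand
  congr 1
  · rw [Finset.sum_map]; rfl
  · have hσ : ∀ i, i ∈ Sᶜ ↔ σ i ∈ (S.map σ.toEmbedding)ᶜ := fun i => by simp
    let e' : Fin Sᶜ.card ≃ Fin (S.map σ.toEmbedding)ᶜ.card :=
      ((Sᶜ.orderIsoOfFin rfl).toEquiv.trans (σ.subtypeEquiv hσ)).trans
        ((S.map σ.toEmbedding)ᶜ.orderIsoOfFin rfl).symm.toEquiv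
    refine h.apply_eq_of_equiv a
      (finSumFinEquiv.symm.trans (((Equiv.refl _).sumCongr e').trans finSumFinEquiv)) _ _ ?_
    intro i
    refine Fin.addCases (fun i => ?_) (fun i => ?_) i
    · simp
    · have : (S.map σ.toEmbedding)ᶜ.orderEmbOfFin rfl (e' i) = σ (Sᶜ.orderEmbOfFin rfl i) := by
        have h1 : (S.map σ.toEmbedding)ᶜ.orderIsoOfFin rfl (e' i)
            = σ.subtypeEquiv hσ (Sᶜ.orderIsoOfFin rfl i) := by
          simp [e']
        exact congrArg Subtype.val h1
      simp [this]

variable [FirstCountableTopology A]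

lemma RapidFamily.continuous_integral {m : ℝ} (hm : 0 ≤ m) (h : RapidFamily Φ)
    (f : 𝓢(Spacetime, ℂ)) {N : ℕ} (S : Finset (Fin N)) (j : ℕ) :
    Continuous fun q : A × (Fin N → Momentum) =>
      ∫ η, wickIntegrand m f (Φ q.1) q.2 S j η ∂(OmegaPi m (Fin j)) := by
  obtain ⟨C, hC⟩ := h.wickIntegrand_bound hm f S j 0
  have hC' : ∀ (q : A × (Fin N → Momentum)) (η : Fin j → Momentum),
      ‖wickIntegrand m f (Φ q.1) q.2 S j η‖ ≤ C * (weight η ^ 4)⁻¹ := fun q η => by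
    have := hC q.1 q.2 η
    rwa [pow_zero, one_mul] at this
  have hc : ∀ η : Fin j → Momentum, Continuous fun q : A × (Fin N → Momentum) =>
      wickIntegrand m f (Φ q.1) q.2 S j η := fun η => by
    have h1 : Continuous fun q : A × (Fin N → Momentum) => (q, η) := by fun_prop
    have h2 := (h.continuous_wickIntegrand (m := m) f S j).comp h1
    simpa only [Function.comp_def] using h2
  have hm' : ∀ q : A × (Fin N → Momentum), AEStronglyMeasurable
      (fun η => wickIntegrand m f (Φ q.1) q.2 S j η) (OmegaPi m (Fin j)) := fun q =>
    (h.integrable_wickIntegrand hm f S j q.1 q.2).aestronglyMeasurable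
  exact continuous_of_dominated hm' (fun q => ae_of_all _ (hC' q))
    ((integrable_weight m j).const_mul C) (ae_of_all _ hc)

lemma RapidFamily.wickValue {m : ℝ} (hm : 0 ≤ m) (h : RapidFamily Φ) (l : ℕ)
    (f : 𝓢(Spacetime, ℂ)) : RapidFamily fun a => wickValue m l f (Φ a) where
  finite := by
    obtain ⟨M₀, hM₀⟩ := h.finite
    refine ⟨M₀ + l, fun a M hM ζ => ?_⟩
    rw [WickExp.wickValue, Finset.sum_eq_zero, mul_zero]
    intro j hj
    rw [Finset.sum_eq_zero, mul_zero]
    intro S hS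
    have h1 : S.card = l - j := (Finset.mem_powersetCard.1 hS).2
    have h2 : Sᶜ.card = M - S.card := by rw [Finset.card_compl, Fintype.card_fin]
    have h3 : ∀ η, wickIntegrand m f (Φ a) ζ S j η = 0 := fun η => by
      rw [wickIntegrand, hM₀ a _ (by omega), mul_zero]
    simp [h3]
  cont M := by
    unfold WickExp.wickValue
    have := fun S j => h.continuous_integral hm f (N := M) S j
    fun_prop
  decay M r := by
    choose C hC using fun S j => h.wickIntegrand_bound hm f (N := M) S j r
    have hI : ∀ S j a ζ, weight ζ ^ r * ‖∫ η, wickIntegrand m f (Φ a) ζ S j η ∂(OmegaPi m (Fin j))‖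
        ≤ ∫ η, C S j * (weight η ^ 4)⁻¹ ∂(OmegaPi m (Fin j)) := by
      intro S j a ζ
      have hw : 0 ≤ weight ζ ^ r := (pow_pos (weight_pos ζ) r).le
      have h1 : weight ζ ^ r * ‖∫ η, wickIntegrand m f (Φ a) ζ S j η ∂(OmegaPi m (Fin j))‖
          = ‖∫ η, ((weight ζ ^ r : ℝ) : ℂ) * wickIntegrand m f (Φ a) ζ S j η
              ∂(OmegaPi m (Fin j))‖ := by
        rw [integral_const_mul, norm_mul, Complex.norm_real, Real.norm_of_nonneg hw]
      rw [h1]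
      refine norm_integral_le_of_norm_le ((integrable_weight m j).const_mul _)
        (ae_of_all _ fun η => ?_)
      rw [norm_mul, Complex.norm_real, Real.norm_of_nonneg hw]
      exact hC S j a ζ η
    refine ⟨‖((√Real.pi ^ l / (2 * Real.pi) ^ (2 * ((l : ℤ) - 1)) : ℝ) : ℂ)‖ *
      ∑ j ∈ Finset.range (l + 1), ‖((√(((M + 2 * j - l)! : ℝ) / (M ! : ℝ)) : ℝ) : ℂ)‖ *
        ∑ S ∈ Finset.powersetCard (l - j) (Finset.univ : Finset (Fin M)),
          ‖((l ! : ℂ) / (j ! : ℂ))‖ * ∫ η, C S j * (weight η ^ 4)⁻¹ ∂(OmegaPi m (Fin j)),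
      fun a ζ => ?_⟩
    have hw : 0 ≤ weight ζ ^ r := (pow_pos (weight_pos ζ) r).le
    rw [WickExp.wickValue, norm_mul, mul_left_comm]
    gcongr
    refine (mul_le_mul_of_nonneg_left (norm_sum_le _ _) hw).trans ?_
    rw [Finset.mul_sum]
    refine Finset.sum_le_sum fun j _ => ?_
    rw [norm_mul, mul_left_comm]
    gcongr
    refine (mul_le_mul_of_nonneg_left (norm_sum_le _ _) hw).trans ?_
    rw [Finset.mul_sum]
    refine Finset.sum_le_sum fun S _ => ?_
    rw [norm_mul, mul_left_comm]
    gcongr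
    exact hI S j a ζ
  symm a M σ ζ := by
    have hS : ∀ j, ∑ S ∈ Finset.powersetCard (l - j) (Finset.univ : Finset (Fin M)),
        ((l ! : ℂ) / (j ! : ℂ)) * ∫ η, wickIntegrand m f (Φ a) (ζ ∘ σ) S j η ∂(OmegaPi m (Fin j))
        = ∑ S ∈ Finset.powersetCard (l - j) (Finset.univ : Finset (Fin M)),
        ((l ! : ℂ) / (j ! : ℂ)) * ∫ η, wickIntegrand m f (Φ a) ζ S j η ∂(OmegaPi m (Fin j)) := by
      intro j
      refine Finset.sum_equiv (Equiv.finsetCongr σ) (fun S => ?_) fun S _ => ?_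
      · simp [Finset.mem_powersetCard]
      · simp only [h.wickIntegrand_comp_perm f σ, Equiv.finsetCongr_apply]
    simp only [WickExp.wickValue, hS]

end

/-- The wave functions of
`e^{-|y₁ - b|H} :φ^{k₁}:(f₁) e^{-|y₂ - y₁|H} :φ^{k₂}:(f₂) ⋯ :φ^{k_n}:(f_n) Φ₀`. -/
def dampedState (m : ℝ) : {n : ℕ} → (Fin n → 𝓢(Spacetime, ℂ)) → (Fin n →₀ ℕ) → (Fin n → ℝ) → ℝ →
    (M : ℕ) → (Fin M → Momentum) → ℂ
  | 0, _, _, _, _ => vacFn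
  | _ + 1, f, k, y, b =>
    damp m (y 0 - b) (wickValue m (k 0) (f 0)
      (dampedState m (Fin.tail f) k.tail (Fin.tail y) (y 0)))

lemma rapidFamily_dampedState {m : ℝ} (hm : 0 ≤ m) {n : ℕ} (f : Fin n → 𝓢(Spacetime, ℂ))
    (k : Fin n →₀ ℕ) :
    RapidFamily fun q : (Fin n → ℝ) × ℝ => dampedState m f k q.1 q.2 := by
  induction n with
  | zero => exact rapidFamily_vacFn
  | succ n ih =>
    have h1 : Continuous fun q : (Fin (n + 1) → ℝ) × ℝ => (Fin.tail q.1, q.1 0) := by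
      unfold Fin.tail; fun_prop
    exact RapidFamily.damp m (((ih (Fin.tail f) k.tail).comp h1).wickValue hm (k 0) (f 0))
      (s := fun q : (Fin (n + 1) → ℝ) × ℝ => q.1 0 - q.2) (by fun_prop)

/-! ### Fock space vectors with given wave functions -/

lemma RapidFamily.memLp {A : Type} [TopologicalSpace A]
    {Φ : A → (M : ℕ) → (Fin M → Momentum) → ℂ} (h : RapidFamily Φ) (m : ℝ) (a : A) (N : ℕ) :
    MemLp (Φ a N) 2 (OmegaPi m (Fin N)) := by
  have hc : Continuous (Φ a N) := by
    have h1 : Continuous fun ζ : Fin N → Momentum => (a, ζ) := by fun_prop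
    exact (h.cont N).comp h1
  obtain ⟨C, hC⟩ := h.decay N 2
  rw [memLp_two_iff_integrable_sq_norm hc.aestronglyMeasurable]
  refine ((integrable_weight m N).const_mul (C ^ 2)).mono'
    (hc.norm.pow 2).aestronglyMeasurable (ae_of_all _ fun ζ => ?_)
  have hw := weight_pos ζ
  rw [Real.norm_of_nonneg (by positivity), ← div_eq_mul_inv, le_div_iff₀ (by positivity)]
  calc ‖Φ a N ζ‖ ^ 2 * weight ζ ^ 4 = (weight ζ ^ 2 * ‖Φ a N ζ‖) ^ 2 := by ring
    _ ≤ C ^ 2 := by gcongr; exact hC a ζ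

lemma RapidFamily.exists_fock {A : Type} [TopologicalSpace A]
    {Φ : A → (M : ℕ) → (Fin M → Momentum) → ℂ} (h : RapidFamily Φ) (m : ℝ) (a : A) :
    ∃ Ψ : Fock m, ∀ N, ∀ᵐ ξ ∂(OmegaPi m (Fin N)), wave Ψ N ξ = Φ a N ξ := by
  let g : (N : ℕ) → symL2 m N := fun N => ⟨(h.memLp m a N).toLp, fun σ => by
    have h0 := (h.memLp m a N).coeFn_toLp
    filter_upwards [h0, (quasi_comp m σ σ.injective).ae h0] with ξ h1 h2
    rw [h1, h2, h.symm a N σ ξ]⟩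
  have hg : Memℓp g 2 := by
    obtain ⟨M₀, hM₀⟩ := h.finite
    refine memℓp_gen (summable_of_ne_finset_zero (s := Finset.range (M₀ + 1)) fun N hN => ?_)
    have h0 : g N = 0 := by
      apply Subtype.ext
      apply Lp.ext
      have hz := Lp.coeFn_zero ℂ 2 (OmegaPi m (Fin N))
      filter_upwards [(h.memLp m a N).coeFn_toLp, hz] with ξ h1 h2
      refine h1.trans (Eq.trans ?_ h2.symm)
      exact hM₀ a N (by simpa [Nat.lt_succ_iff] using hN) ξ
    rw [h0]; simp
  exact ⟨⟨g, hg⟩, fun N => (h.memLp m a N).coeFn_toLp⟩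

lemma wave_vacuum (m : ℝ) (N : ℕ) :
    ∀ᵐ ξ ∂(OmegaPi m (Fin N)), wave (vacuum m) N ξ = vacFn N ξ := by
  rcases eq_or_ne N 0 with rfl | hN
  · have : (vacuum m) 0 = _ := lp.single_apply_self 2 0 _
    rw [wave, this]
    filter_upwards [(memLp_one m).coeFn_toLp] with ξ h1
    rw [h1]; rfl
  · have : (vacuum m) N = 0 := lp.single_apply_ne 2 0 _ hN
    rw [wave, this]
    filter_upwards [Lp.coeFn_zero ℂ 2 (OmegaPi m (Fin N))] with ξ h1
    refine h1.trans ?_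
    simp [vacFn, hN]

lemma inner_vacuum {m : ℝ} {Ψ : Fock m} {Φ : (M : ℕ) → (Fin M → Momentum) → ℂ}
    (h : ∀ N, ∀ᵐ ξ ∂(OmegaPi m (Fin N)), wave Ψ N ξ = Φ N ξ) (ξ₀ : Fin 0 → Momentum) :
    inner ℂ (vacuum m) Ψ = Φ 0 ξ₀ := by
  rw [vacuum, lp.inner_single_left, Submodule.coe_inner, L2.inner_def]
  have h1 : ∀ᵐ ξ ∂(OmegaPi m (Fin 0)), inner ℂ
      (((memLp_one m).toLp : Lp ℂ 2 (OmegaPi m (Fin 0))) ξ)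
      ((Ψ 0 : Lp ℂ 2 (OmegaPi m (Fin 0))) ξ) = Φ 0 ξ₀ := by
    filter_upwards [(memLp_one m).coeFn_toLp, h 0] with ξ h1 h2
    rw [h1]
    have h3 : (Ψ 0 : Lp ℂ 2 (OmegaPi m (Fin 0))) ξ = Φ 0 ξ := h2
    rw [h3, Subsingleton.elim ξ ξ₀]
    simp
  rw [integral_congr_ae h1, OmegaPi, Measure.pi_of_empty _ ξ₀]
  simp

/-! ### Products of operators, through their graphs -/

lemma mem_graph_opMul {E : Type*} [AddCommGroup E] [Module ℂ E] {A B : E →ₗ.[ℂ] E} {x y z : E}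
    (hB : (x, y) ∈ B.graph) (hA : (y, z) ∈ A.graph) : (x, z) ∈ (opMul A B).graph := by
  rw [LinearPMap.mem_graph_iff] at hA hB ⊢
  obtain ⟨⟨x, hx⟩, rfl, rfl⟩ := hB
  obtain ⟨⟨y, hy⟩, h1, rfl⟩ := hA
  simp only at h1
  subst h1
  exact ⟨⟨x, ⟨⟨x, hx⟩, hy, rfl⟩, hx⟩, rfl, rfl⟩

lemma mem_graph_smul {E : Type*} [AddCommGroup E] [Module ℂ E] {A : E →ₗ.[ℂ] E} {x y : E}
    (c : ℂ) (hA : (x, y) ∈ A.graph) : (x, c • y) ∈ (c • A).graph := by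
  rw [LinearPMap.mem_graph_iff] at hA ⊢
  obtain ⟨⟨x, hx⟩, rfl, rfl⟩ := hA
  exact ⟨⟨x, hx⟩, rfl, rfl⟩

lemma wickPower_graph (m : ℝ) (l : ℕ) (f : 𝓢(Spacetime, ℂ)) :
    (wickPower m l f).graph = wickGraph m l f :=
  Submodule.toLinearPMap_graph_eq _ (wickGraph_functional m l f)

/-- `:φ^l:(f)` maps rapidly decreasing states to rapidly decreasing states. -/
lemma RapidFamily.mem_wickGraph {A : Type} [TopologicalSpace A]
    {Φ : A → (M : ℕ) → (Fin M → Momentum) → ℂ} {m : ℝ} (hm : 0 ≤ m) (h : RapidFamily Φ) (l : ℕ)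
    (f : 𝓢(Spacetime, ℂ)) (a : A) {Ψ₁ Ψ₂ : Fock m}
    (h₁ : ∀ N, ∀ᵐ ξ ∂(OmegaPi m (Fin N)), wave Ψ₁ N ξ = Φ a N ξ)
    (h₂ : ∀ N, ∀ᵐ ξ ∂(OmegaPi m (Fin N)), wave Ψ₂ N ξ = WickExp.wickValue m l f (Φ a) N ξ) :
    (Ψ₁, Ψ₂) ∈ wickGraph m l f := by
  intro N
  filter_upwards [wickIntegrand_ae f h₁ N, h₂ N] with ξ h3 h4
  obtain ⟨h5, h6⟩ := wick_congr (l := l) h3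
  exact ⟨h6.2 fun j _ S _ => h.integrable_wickIntegrand hm f S j a ξ, h4.trans h5.symm⟩

lemma damp_zero (m : ℝ) (Φ : (M : ℕ) → (Fin M → Momentum) → ℂ) : damp m 0 Φ = Φ := by
  funext M ζ
  simp [damp]

lemma exists_mem_graph_wickExpProdCoeff {m : ℝ} (hm : 0 ≤ m) {n : ℕ}
    (f : Fin n → 𝓢(Spacetime, ℂ)) (k : Fin n →₀ ℕ) :
    ∃ Ψ : Fock m, (∀ N, ∀ᵐ ξ ∂(OmegaPi m (Fin N)), wave Ψ N ξ = dampedState m f k 0 0 N ξ) ∧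
      (vacuum m, (∏ i, ((k i)! : ℂ)⁻¹) • Ψ) ∈ (wickExpProdCoeff m f k).graph := by
  induction n with
  | zero =>
    refine ⟨vacuum m, wave_vacuum m, ?_⟩
    rw [LinearPMap.mem_graph_iff]
    refine ⟨⟨vacuum m, trivial⟩, rfl, ?_⟩
    rw [Finset.univ_eq_empty, Finset.prod_empty, one_smul]
    rfl
  | succ n ih =>
    obtain ⟨Ψ, h1, h2⟩ := ih (Fin.tail f) k.tail
    have hR := (rapidFamily_dampedState hm (Fin.tail f) k.tail).wickValue hm (k 0) (f 0)
    obtain ⟨Ψ', h3⟩ := hR.exists_fock m 0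
    refine ⟨Ψ', fun N => ?_, ?_⟩
    · have : dampedState m f k 0 0 = wickValue m (k 0) (f 0)
          (dampedState m (Fin.tail f) k.tail 0 0) := by
        rw [dampedState]
        simp only [Pi.zero_apply, sub_zero, damp_zero]
        rfl
      rw [this]
      exact h3 N
    · have h4 : (Ψ, Ψ') ∈ (wickPower m (k 0) (f 0)).graph := by
        rw [wickPower_graph]
        exact (rapidFamily_dampedState hm (Fin.tail f) k.tail).mem_wickGraph hm (k 0) (f 0) 0 h1 h3
      have h5 := mem_graph_smul ((k 0)! : ℂ)⁻¹ h4
      have h6 := (wickExpCoeff m (f 0) (k 0)).graph.smul_mem (∏ i, ((k.tail i)! : ℂ)⁻¹) h5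
      have h7 := mem_graph_opMul h2 h6
      have h8 : wickExpProdCoeff m f k
          = opMul (wickExpCoeff m (f 0) (k 0)) (wickExpProdCoeff m (Fin.tail f) k.tail) := by
        simp only [wickExpProdCoeff, opProd, List.ofFn_succ, List.foldr_cons]
        rfl
      rw [h8, Fin.prod_univ_succ, mul_comm, mul_smul]
      exact h7

lemma vev_eq {m : ℝ} (hm : 0 ≤ m) {n : ℕ} (f : Fin n → 𝓢(Spacetime, ℂ)) (k : Fin n →₀ ℕ)
    (ξ₀ : Fin 0 → Momentum) :
    vacuum m ∈ (wickExpProdCoeff m f k).domain ∧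
      MvPowerSeries.coeff k (vev m f)
        = (∏ i, ((k i)! : ℂ)⁻¹) * dampedState m f k 0 0 0 ξ₀ := by
  obtain ⟨Ψ, h1, h2⟩ := exists_mem_graph_wickExpProdCoeff hm f k
  obtain ⟨⟨x, hx⟩, rfl, h4⟩ := (LinearPMap.mem_graph_iff _).1 h2
  refine ⟨hx, ?_⟩
  have : MvPowerSeries.coeff k (vev m f) = vev m f k := rfl
  rw [this, vev, dif_pos hx, h4, inner_smul_right, inner_vacuum h1 ξ₀]

/-! ### Plane waves and the two-point function -/

/-- The normalization `π^{1/2} (2π)⁻²` of one leg of a Wick power. -/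
def legConst : ℂ := ((√Real.pi : ℝ) : ℂ) * ((2 * Real.pi : ℝ) : ℂ)⁻¹ ^ 2

/-- The plane wave created at the point `x` with imaginary time `s`. -/
def outWave (m s : ℝ) (x : Spacetime) (ξ : Momentum) : ℂ :=
  legConst * Complex.exp (Complex.I * (mink (onShell m ξ) x : ℂ)) *
    (Real.exp (-(s * energy m ξ)) : ℂ)

/-- The plane wave absorbed at the point `x`. -/
def inWave (m : ℝ) (x : Spacetime) (η : Momentum) : ℂ :=
  legConst * Complex.exp (-Complex.I * (mink (onShell m η) x : ℂ))

lemma norm_exp_neg_I_mul (θ : ℝ) : ‖Complex.exp (-Complex.I * (θ : ℂ))‖ = 1 := by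
  rw [Complex.norm_exp]; simp

lemma norm_exp_I_mul (θ : ℝ) : ‖Complex.exp (Complex.I * (θ : ℂ))‖ = 1 := by
  rw [Complex.norm_exp]; simp

lemma legConst_sq : legConst ^ 2 = ((2 * (2 * Real.pi) ^ 3 : ℝ) : ℂ)⁻¹ := by
  have h : √Real.pi ^ 2 = Real.pi := Real.sq_sqrt Real.pi_pos.le
  have h1 : (√Real.pi * (2 * Real.pi)⁻¹ ^ 2) ^ 2 = (2 * (2 * Real.pi) ^ 3)⁻¹ := by
    rw [mul_pow, h]
    have := Real.pi_pos
    field_simp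
  have h2 := congrArg (fun r : ℝ => (r : ℂ)) h1
  push_cast at h2
  rw [legConst]
  push_cast
  exact h2

lemma outWave_add (m s s' : ℝ) (x : Spacetime) (ξ : Momentum) :
    outWave m (s + s') x ξ = (Real.exp (-(s * energy m ξ)) : ℂ) * outWave m s' x ξ := by
  have : Real.exp (-((s + s') * energy m ξ))
      = Real.exp (-(s * energy m ξ)) * Real.exp (-(s' * energy m ξ)) := by
    rw [← Real.exp_add]; ring_nf
  rw [outWave, outWave, this]
  push_cast
  ring

lemma continuous_outWave (m s : ℝ) :
    Continuous fun q : Spacetime × Momentum => outWave m s q.1 q.2 := by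
  have h1 := continuous_energy m
  have h2 : Continuous fun q : Spacetime × Momentum => mink (onShell m q.2) q.1 :=
    Continuous.mink ((continuous_onShell m).comp continuous_snd) continuous_fst
  unfold outWave
  fun_prop

lemma norm_outWave_le (m : ℝ) {s : ℝ} (hs : 0 ≤ s) (x : Spacetime) (ξ : Momentum) :
    ‖outWave m s x ξ‖ ≤ ‖legConst‖ := by
  have h0 := mul_nonneg hs (energy_nonneg m ξ)
  rw [outWave, norm_mul, norm_mul, norm_exp_I_mul, mul_one, Complex.norm_real,
    Real.norm_of_nonneg (Real.exp_pos _).le]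
  exact mul_le_of_le_one_right (norm_nonneg _) (Real.exp_le_one_iff.2 (by linarith))

lemma continuous_inWave (m : ℝ) :
    Continuous fun q : Spacetime × Momentum => inWave m q.1 q.2 := by
  have h2 : Continuous fun q : Spacetime × Momentum => mink (onShell m q.2) q.1 :=
    Continuous.mink ((continuous_onShell m).comp continuous_snd) continuous_fst
  unfold inWave
  fun_prop

lemma norm_inWave_mul_outWave (m s : ℝ) (x x' : Spacetime) (p : Momentum) :
    ‖inWave m x p * outWave m s x' p‖ = ‖legConst‖ ^ 2 * Real.exp (-(s * energy m p)) := by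
  rw [norm_mul, inWave, outWave, norm_mul, norm_mul, norm_mul, norm_exp_I_mul, norm_exp_neg_I_mul,
    Complex.norm_real, Real.norm_of_nonneg (Real.exp_pos _).le]
  ring

lemma integrable_inWave_mul_outWave (m : ℝ) {s : ℝ} (hs : 0 < s) (x x' : Spacetime) :
    Integrable (fun p => inWave m x p * outWave m s x' p) (Omega m) := by
  refine ((integrable_exp_neg_energy m hs).const_mul (‖legConst‖ ^ 2)).mono' ?_
    (ae_of_all _ fun p => (norm_inWave_mul_outWave m s x x' p).le)
  have h1 := (continuous_inWave m).comp (Continuous.prodMk_right x)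
  have h2 := (continuous_outWave m s).comp (Continuous.prodMk_right x')
  exact (h1.mul h2).aestronglyMeasurable

lemma twoPoint_eq_integral (m s : ℝ) (x x' : Spacetime) :
    twoPoint m (x - x') (-s) = ∫ p, inWave m x p * outWave m s x' p ∂(Omega m) := by
  rw [integral_Omega, twoPoint, ← integral_const_mul, ← legConst_sq]
  refine integral_congr_ae (ae_of_all _ fun p => ?_)
  simp only [inWave, outWave]
  have h1 : mink (onShell m p) (x - x') = energy m p * (x - x') 0
      - (p 0 * (x - x') 1 + p 1 * (x - x') 2 + p 2 * (x - x') 3) := by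
    simp [mink, onShell]; ring
  have h2 : Complex.exp (-Complex.I * (energy m p : ℂ) *
        (((x - x') 0 : ℝ) + Complex.I * ((-s : ℝ) : ℂ))) * Complex.exp (Complex.I *
        ((p 0 * (x - x') 1 + p 1 * (x - x') 2 + p 2 * (x - x') 3 : ℝ) : ℂ))
      = Complex.exp (-Complex.I * (mink (onShell m p) x : ℂ)) *
        Complex.exp (Complex.I * (mink (onShell m p) x' : ℂ)) *
        (Real.exp (-(s * energy m p)) : ℂ) := by
    rw [Complex.ofReal_exp, ← Complex.exp_add, ← Complex.exp_add, ← Complex.exp_add]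
    congr 1
    have h3 : (mink (onShell m p) x : ℂ) = (mink (onShell m p) x' : ℂ) + ((energy m p * (x - x') 0
      - (p 0 * (x - x') 1 + p 1 * (x - x') 2 + p 2 * (x - x') 3) : ℝ) : ℂ) := by
      rw [← h1, mink_sub_right]; push_cast; ring
    rw [h3]
    push_cast
    linear_combination (-(energy m p : ℂ) * -s) * Complex.I_sq
  rw [mul_assoc (((energy m p : ℝ) : ℂ)⁻¹), h2]
  ring

/-! ### Bounded continuous families of polynomials -/

/-- A bounded continuous function. -/
def BddCont {Z : Type*} [TopologicalSpace Z] (F : Z → ℂ) : Prop :=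
  Continuous F ∧ ∃ C, ∀ z, ‖F z‖ ≤ C

section

variable {Z : Type*} [TopologicalSpace Z]

lemma BddCont.const (c : ℂ) : BddCont fun _ : Z => c := ⟨continuous_const, ‖c‖, fun _ => le_rfl⟩

lemma BddCont.mul {F G : Z → ℂ} (hF : BddCont F) (hG : BddCont G) :
    BddCont fun z => F z * G z := by
  obtain ⟨h1, C, hC⟩ := hF
  obtain ⟨h2, D, hD⟩ := hG
  refine ⟨h1.mul h2, C * D, fun z => ?_⟩
  rw [norm_mul]
  exact mul_le_mul (hC z) (hD z) (norm_nonneg _) ((norm_nonneg _).trans (hC z))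

lemma BddCont.sum {ι : Type*} {s : Finset ι} {F : ι → Z → ℂ} (h : ∀ i ∈ s, BddCont (F i)) :
    BddCont fun z => ∑ i ∈ s, F i z := by
  classical
  induction s using Finset.induction_on with
  | empty => simpa using BddCont.const 0
  | insert a s ha ih =>
    obtain ⟨h1, C, hC⟩ := h a (Finset.mem_insert_self a s)
    obtain ⟨h2, D, hD⟩ := ih fun i hi => h i (Finset.mem_insert_of_mem hi)
    simp only [Finset.sum_insert ha]
    exact ⟨h1.add h2, C + D, fun z => (norm_add_le _ _).trans (add_le_add (hC z) (hD z))⟩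

lemma BddCont.comp {Y : Type*} [TopologicalSpace Y] {F : Z → ℂ} (hF : BddCont F) {g : Y → Z}
    (hg : Continuous g) : BddCont fun y => F (g y) :=
  ⟨hF.1.comp hg, hF.2.imp fun _ h y => h (g y)⟩

/-- A family of polynomials with bounded continuous coefficients. -/
def PolyBddCont {n : ℕ} (P : Z → MvPolynomial (Fin n) ℂ) : Prop :=
  ∀ k, BddCont fun z => MvPolynomial.coeff k (P z)

lemma PolyBddCont.const {n : ℕ} (P : MvPolynomial (Fin n) ℂ) : PolyBddCont fun _ : Z => P :=
  fun _ => BddCont.const _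

lemma PolyBddCont.C {n : ℕ} {F : Z → ℂ} (hF : BddCont F) :
    PolyBddCont fun z => (MvPolynomial.C (F z) : MvPolynomial (Fin n) ℂ) := by
  classical
  intro k
  simp only [MvPolynomial.coeff_C]
  split_ifs
  · exact hF
  · exact BddCont.const 0

lemma PolyBddCont.mul {n : ℕ} {P Q : Z → MvPolynomial (Fin n) ℂ} (hP : PolyBddCont P)
    (hQ : PolyBddCont Q) : PolyBddCont fun z => P z * Q z := by
  classical
  intro k
  simp only [MvPolynomial.coeff_mul]
  exact BddCont.sum fun a _ => (hP a.1).mul (hQ a.2)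

lemma PolyBddCont.sum {n : ℕ} {ι : Type*} {s : Finset ι} {P : ι → Z → MvPolynomial (Fin n) ℂ}
    (h : ∀ i ∈ s, PolyBddCont (P i)) : PolyBddCont fun z => ∑ i ∈ s, P i z := by
  intro k
  simp only [MvPolynomial.coeff_sum]
  exact BddCont.sum fun i hi => h i hi k

lemma PolyBddCont.prod {n : ℕ} {ι : Type*} {s : Finset ι} {P : ι → Z → MvPolynomial (Fin n) ℂ}
    (h : ∀ i ∈ s, PolyBddCont (P i)) : PolyBddCont fun z => ∏ i ∈ s, P i z := by
  classical
  induction s using Finset.induction_on with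
  | empty => simpa using PolyBddCont.const 1
  | insert a s ha ih =>
    simp only [Finset.prod_insert ha]
    exact (h a (Finset.mem_insert_self a s)).mul
      (ih fun i hi => h i (Finset.mem_insert_of_mem hi))

lemma BddCont.genCoeff {n : ℕ} {t : Z → Fin n → Fin n → ℂ}
    (ht : ∀ i j, i < j → BddCont fun z => t z i j) {Q : Z → MvPolynomial (Fin n) ℂ}
    (hQ : PolyBddCont Q) (k : Fin n →₀ ℕ) : BddCont fun z => genCoeff (t z) k (Q z) := by
  have h1 : PolyBddCont fun z => quadForm (t z) :=
    PolyBddCont.sum fun i _ => PolyBddCont.sum fun j hj =>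
      (PolyBddCont.const _).mul (PolyBddCont.C (ht i j (Finset.mem_Ioi.1 hj)))
  refine BddCont.sum fun d _ => (BddCont.const _).mul ?_
  have h2 : PolyBddCont fun z => quadForm (t z) ^ d := by
    simpa using PolyBddCont.prod (s := Finset.range d) fun _ _ => h1
  exact (h2.mul hQ) k

end

lemma bddCont_twoPoint (m : ℝ) {s : ℝ} (hs : s < 0) : BddCont fun x => twoPoint m x s := by
  have h : ∀ x, twoPoint m x s = ∫ p, inWave m x p * outWave m (-s) 0 p ∂(Omega m) := fun x => by
    rw [← twoPoint_eq_integral, sub_zero, neg_neg]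
  simp only [h]
  have hI := (integrable_exp_neg_energy m (neg_pos.2 hs)).const_mul (‖legConst‖ ^ 2)
  refine ⟨?_, _, fun x => norm_integral_le_of_norm_le hI
    (ae_of_all _ fun p => (norm_inWave_mul_outWave m (-s) x 0 p).le)⟩
  refine continuous_of_dominated
    (fun x => (integrable_inWave_mul_outWave m (neg_pos.2 hs) x 0).aestronglyMeasurable)
    (fun x => ae_of_all _ fun p => (norm_inWave_mul_outWave m (-s) x 0 p).le) hI
    (ae_of_all _ fun p => ?_)
  have h1 : Continuous fun x : Spacetime => (x, p) := by fun_prop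
  exact ((continuous_inWave m).comp h1).mul continuous_const

/-! ### The states with unsmeared vertices -/

/-- The two-point functions of the points with times `x_a⁰ + i y_a`. -/
def twoPoints (m : ℝ) {n : ℕ} (y : Fin n → ℝ) (x : Fin n → Spacetime) (a c : Fin n) : ℂ :=
  twoPoint m (x a - x c) (y a - y c)

/-- The one-particle generating function `∑_a X_a u_a(ξ)`. -/
def outPoly (m : ℝ) {n : ℕ} (y : Fin n → ℝ) (b : ℝ) (x : Fin n → Spacetime) (ξ : Momentum) :
    MvPolynomial (Fin n) ℂ :=
  ∑ a, MvPolynomial.X a * MvPolynomial.C (outWave m (y a - b) (x a) ξ)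

/-- The wave functions of `e^{bH} :φ^{k₁}:(z₁) ⋯ :φ^{k_n}:(z_n) Φ₀` at the points `z_a` with times
`x_a⁰ + i y_a`. -/
def pointState (m : ℝ) {n : ℕ} (k : Fin n →₀ ℕ) (y : Fin n → ℝ) (b : ℝ) (x : Fin n → Spacetime)
    (N : ℕ) (ξ : Fin N → Momentum) : ℂ :=
  (∏ a, ((k a)! : ℂ)) * ((√(N ! : ℝ) : ℝ) : ℂ)⁻¹ *
    genCoeff (twoPoints m y x) k (∏ r, outPoly m y b x (ξ r))

lemma outPoly_add (m : ℝ) {n : ℕ} (y : Fin n → ℝ) (b δ : ℝ) (x : Fin n → Spacetime)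
    (ξ : Momentum) :
    outPoly m y b x ξ
      = MvPolynomial.C (Real.exp (-(δ * energy m ξ)) : ℂ) * outPoly m y (b + δ) x ξ := by
  simp only [outPoly, Finset.mul_sum]
  refine Finset.sum_congr rfl fun a _ => ?_
  have : y a - b = δ + (y a - (b + δ)) := by ring
  rw [this, outWave_add, map_mul]
  ring

lemma pointState_add (m : ℝ) {n : ℕ} (k : Fin n →₀ ℕ) (y : Fin n → ℝ) (b δ : ℝ)
    (x : Fin n → Spacetime) (N : ℕ) (ξ : Fin N → Momentum) :
    pointState m k y b x N ξ
      = (Real.exp (-(δ * ∑ r, energy m (ξ r))) : ℂ) * pointState m k y (b + δ) x N ξ := by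
  have h1 : ∏ r, outPoly m y b x (ξ r)
      = MvPolynomial.C (Real.exp (-(δ * ∑ r, energy m (ξ r))) : ℂ) *
        ∏ r, outPoly m y (b + δ) x (ξ r) := by
    rw [Finset.prod_congr rfl fun r _ => outPoly_add m y b δ x (ξ r), Finset.prod_mul_distrib,
      ← map_prod, ← Complex.ofReal_prod, ← Real.exp_sum, Finset.mul_sum, Finset.sum_neg_distrib]
  rw [pointState, pointState, h1, genCoeff_C_mul]
  ring

lemma bddCont_pointState (m : ℝ) {n : ℕ} (k : Fin n →₀ ℕ) {y : Fin n → ℝ} (hy : StrictMono y)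
    {b : ℝ} (hb : ∀ a, b ≤ y a) (N : ℕ) :
    BddCont fun q : (Fin n → Spacetime) × (Fin N → Momentum) => pointState m k y b q.1 N q.2 := by
  refine (BddCont.const _).mul (BddCont.genCoeff (fun i j hij => ?_) ?_ k)
  · exact (bddCont_twoPoint m (sub_neg.2 (hy hij))).comp
      (g := fun q : (Fin n → Spacetime) × (Fin N → Momentum) => q.1 i - q.1 j) (by fun_prop)
  · refine PolyBddCont.prod fun r _ => PolyBddCont.sum fun a _ =>
      (PolyBddCont.const _).mul (PolyBddCont.C ?_)
    have h1 : BddCont fun q : Spacetime × Momentum => outWave m (y a - b) q.1 q.2 :=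
      ⟨continuous_outWave m _, _, fun q => norm_outWave_le m (sub_nonneg.2 (hb a)) q.1 q.2⟩
    exact h1.comp
      (g := fun q : (Fin n → Spacetime) × (Fin N → Momentum) => (q.1 a, q.2 r)) (by fun_prop)

/-! ### Contractions -/

lemma genCoeff_prod_sum_mul {n j : ℕ} (t : Fin n → Fin n → ℂ) (k : Fin n →₀ ℕ)
    (v : Fin j → Fin n → ℂ) (Q : MvPolynomial (Fin n) ℂ) :
    genCoeff t k ((∏ r, ∑ a, MvPolynomial.X a * MvPolynomial.C (v r a)) * Q)
      = ∑ c : Fin j → Fin n, (∏ r, v r (c r)) *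
          genCoeff t k ((∏ r, MvPolynomial.X (c r)) * Q) := by
  rw [Finset.prod_univ_sum, Fintype.piFinset_univ, Finset.sum_mul, genCoeff_sum]
  refine Finset.sum_congr rfl fun c _ => ?_
  rw [Finset.prod_mul_distrib, ← map_prod, mul_comm (∏ r, MvPolynomial.X (c r)), mul_assoc,
    genCoeff_C_mul]

/-- Integration of `j` absorbed momenta against the generating function. -/
lemma integral_prod_mul_genCoeff (m : ℝ) {n j : ℕ} (t : Fin n → Fin n → ℂ) (k : Fin n →₀ ℕ)
    (w : Momentum → ℂ) (v : Fin n → Momentum → ℂ)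
    (hi : ∀ a, Integrable (fun p => w p * v a p) (Omega m)) (Q : MvPolynomial (Fin n) ℂ) :
    ∫ η, (∏ r, w (η r)) * genCoeff t k
        ((∏ r, ∑ a, MvPolynomial.X a * MvPolynomial.C (v a (η r))) * Q) ∂(OmegaPi m (Fin j))
      = genCoeff t k ((∑ a, MvPolynomial.X a *
          MvPolynomial.C (∫ p, w p * v a p ∂(Omega m))) ^ j * Q) := by
  have h1 : (∑ a, MvPolynomial.X a * MvPolynomial.C (∫ p, w p * v a p ∂(Omega m))) ^ j
      = ∏ _r : Fin j, ∑ a : Fin n, MvPolynomial.X a *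
          MvPolynomial.C (∫ p, w p * v a p ∂(Omega m)) := by
    rw [Finset.prod_const, Finset.card_univ, Fintype.card_fin]
  rw [h1, genCoeff_prod_sum_mul t k fun _ a => ∫ p, w p * v a p ∂(Omega m)]
  have h2 : ∀ η : Fin j → Momentum, (∏ r, w (η r)) * genCoeff t k
        ((∏ r, ∑ a, MvPolynomial.X a * MvPolynomial.C (v a (η r))) * Q)
      = ∑ c : Fin j → Fin n, (∏ r, w (η r) * v (c r) (η r)) *
          genCoeff t k ((∏ r, MvPolynomial.X (c r)) * Q) := by
    intro η
    rw [genCoeff_prod_sum_mul t k fun r a => v a (η r), Finset.mul_sum]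
    refine Finset.sum_congr rfl fun c _ => ?_
    rw [Finset.prod_mul_distrib, mul_assoc]
  simp only [h2]
  rw [integral_finsetSum]
  · refine Finset.sum_congr rfl fun c _ => ?_
    rw [integral_mul_const, integral_fintype_prod_eq_prod (fun r p => w p * v (c r) p)]
  · intro c _
    exact (Integrable.fintype_prod (μ := fun _ : Fin j => Omega m)
      (f := fun r p => w p * v (c r) p) fun r => hi (c r)).mul_const _

lemma prod_append_compl {R : Type*} [CommMonoid R] (F : Momentum → R) {N j : ℕ}
    (η : Fin j → Momentum) (ξ : Fin N → Momentum) (S : Finset (Fin N)) :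
    ∏ r, F (Fin.append η (ξ ∘ Sᶜ.orderEmbOfFin rfl) r) = (∏ r, F (η r)) * ∏ i ∈ Sᶜ, F (ξ i) := by
  have h : ∏ r, F (ξ (Sᶜ.orderEmbOfFin rfl r)) = ∏ i ∈ Sᶜ, F (ξ i) := by
    rw [← Finset.prod_coe_sort Sᶜ, ← (Sᶜ.orderIsoOfFin rfl).toEquiv.prod_comp]
    rfl
  rw [Fin.prod_univ_add, ← h]
  simp only [Fin.append_left, Fin.append_right, Function.comp_apply]

/-- The integral over the absorbed momenta in the action of an unsmeared Wick power at `x 0` on the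
state created at the other points. -/
def contraction (m : ℝ) {n : ℕ} (k : Fin (n + 1) →₀ ℕ) (y : Fin (n + 1) → ℝ)
    (x : Fin (n + 1) → Spacetime) {N : ℕ} (ξ : Fin N → Momentum) (S : Finset (Fin N)) (j : ℕ) : ℂ :=
  ∫ η : Fin j → Momentum,
    Complex.exp (-Complex.I *
      (mink (∑ r, onShell m (η r) - ∑ i ∈ S, onShell m (ξ i)) (x 0) : ℂ)) *
    pointState m k.tail (Fin.tail y) (y 0) (Fin.tail x) (j + Sᶜ.card)
      (Fin.append η (ξ ∘ Sᶜ.orderEmbOfFin rfl)) ∂(OmegaPi m (Fin j))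

lemma legConst_pow_mul_contraction (m : ℝ) {n : ℕ} (k : Fin (n + 1) →₀ ℕ) {y : Fin (n + 1) → ℝ}
    (hy : StrictMono y) (x : Fin (n + 1) → Spacetime) {N : ℕ} (ξ : Fin N → Momentum)
    (S : Finset (Fin N)) (j : ℕ) :
    legConst ^ (j + S.card) * contraction m k y x ξ S j
      = (∏ a, ((k.tail a)! : ℂ)) * ((√((j + Sᶜ.card)! : ℝ) : ℝ) : ℂ)⁻¹ *
        (∏ i ∈ S, outWave m 0 (x 0) (ξ i)) *
        genCoeff (twoPoints m (Fin.tail y) (Fin.tail x)) k.tail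
          ((∑ a : Fin n, MvPolynomial.X a * MvPolynomial.C (twoPoints m y x 0 a.succ)) ^ j *
            ∏ i ∈ Sᶜ, outPoly m (Fin.tail y) (y 0) (Fin.tail x) (ξ i)) := by
  have hpos : ∀ a : Fin n, 0 < y a.succ - y 0 := fun a => sub_pos.2 (hy (Fin.succ_pos a))
  have ht : ∀ a : Fin n, twoPoints m y x 0 a.succ
      = ∫ p, inWave m (x 0) p * outWave m (y a.succ - y 0) (x a.succ) p ∂(Omega m) := fun a => by
    rw [← twoPoint_eq_integral, twoPoints, neg_sub]
  simp only [ht]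
  rw [← integral_prod_mul_genCoeff m _ _ (inWave m (x 0))
    (fun a : Fin n => outWave m (y a.succ - y 0) (x a.succ))
    (fun a => integrable_inWave_mul_outWave m (hpos a) _ _), contraction, ← integral_const_mul,
    ← integral_const_mul]
  refine integral_congr_ae (ae_of_all _ fun η => ?_)
  simp only
  have h1 : ∏ r, outPoly m (Fin.tail y) (y 0) (Fin.tail x)
        (Fin.append η (ξ ∘ Sᶜ.orderEmbOfFin rfl) r)
      = (∏ r, ∑ a : Fin n, MvPolynomial.X a *
          MvPolynomial.C (outWave m (y a.succ - y 0) (x a.succ) (η r))) *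
        ∏ i ∈ Sᶜ, outPoly m (Fin.tail y) (y 0) (Fin.tail x) (ξ i) := by
    exact prod_append_compl (outPoly m (Fin.tail y) (y 0) (Fin.tail x)) η ξ S
  have h2 : legConst ^ (j + S.card) * Complex.exp (-Complex.I *
        (mink (∑ r, onShell m (η r) - ∑ i ∈ S, onShell m (ξ i)) (x 0) : ℂ))
      = (∏ r, inWave m (x 0) (η r)) * ∏ i ∈ S, outWave m 0 (x 0) (ξ i) := by
    simp only [inWave, outWave, zero_mul, neg_zero, Real.exp_zero, Complex.ofReal_one, mul_one]
    rw [Finset.prod_mul_distrib, Finset.prod_mul_distrib, Finset.prod_const, Finset.prod_const,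
      Finset.card_univ, Fintype.card_fin, ← Complex.exp_sum, ← Complex.exp_sum, mink_sub_left,
      mink_sum_left, mink_sum_left, mul_mul_mul_comm, ← Complex.exp_add, pow_add,
      ← Finset.mul_sum, ← Finset.mul_sum]
    congr 2
    push_cast
    ring
  rw [pointState, h1, ← mul_assoc, h2]
  ring

lemma wickConst_mul (l : ℕ) :
    ((√Real.pi ^ l / (2 * Real.pi) ^ (2 * ((l : ℤ) - 1)) : ℝ) : ℂ) * ((2 * Real.pi : ℝ) : ℂ)⁻¹ ^ 2
      = legConst ^ l := by
  have h0 : (2 * Real.pi) ≠ 0 := by positivity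
  have h1 : √Real.pi ^ l / (2 * Real.pi) ^ (2 * ((l : ℤ) - 1)) * (2 * Real.pi)⁻¹ ^ 2
      = (√Real.pi * (2 * Real.pi)⁻¹ ^ 2) ^ l := by
    have h2 : (2 * Real.pi) ^ (2 * ((l : ℤ) - 1))
        = (2 * Real.pi) ^ (2 * l) / (2 * Real.pi) ^ 2 := by
      rw [mul_sub, zpow_sub₀ h0]; norm_cast
    rw [h2, mul_pow _ _ l, ← pow_mul, inv_pow, inv_pow]
    field_simp
  have h2 := congrArg (fun r : ℝ => (r : ℂ)) h1
  rw [legConst]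
  simpa only [Complex.ofReal_mul, Complex.ofReal_pow, Complex.ofReal_inv] using h2

/-- The action of an unsmeared Wick power. -/
lemma sum_contraction (m : ℝ) {n : ℕ} (k : Fin (n + 1) →₀ ℕ) {y : Fin (n + 1) → ℝ}
    (hy : StrictMono y) (x : Fin (n + 1) → Spacetime) {N : ℕ} (ξ : Fin N → Momentum) :
    ((√Real.pi ^ k 0 / (2 * Real.pi) ^ (2 * ((k 0 : ℤ) - 1)) : ℝ) : ℂ) *
      ∑ j ∈ Finset.range (k 0 + 1), ((√(((N + 2 * j - k 0)! : ℝ) / (N ! : ℝ)) : ℝ) : ℂ) *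
        ∑ S ∈ Finset.powersetCard (k 0 - j) (Finset.univ : Finset (Fin N)),
          (((k 0)! : ℂ) / (j ! : ℂ)) *
            (((2 * Real.pi : ℝ) : ℂ)⁻¹ ^ 2 * contraction m k y x ξ S j)
      = pointState m k y (y 0) x N ξ := by
  have hpoly : ∀ r, outPoly m y (y 0) x (ξ r)
      = MvPolynomial.X 0 * MvPolynomial.C (outWave m 0 (x 0) (ξ r))
        + ∑ a : Fin n, MvPolynomial.X a.succ *
          MvPolynomial.C (outWave m (y a.succ - y 0) (x a.succ) (ξ r)) := fun r => by
    rw [outPoly, Fin.sum_univ_succ, sub_self]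
  have hk : k = k.tail.cons (k 0) := (Finsupp.cons_tail k).symm
  rw [pointState]
  simp only [hpoly]
  conv_rhs => rw [hk, genCoeff_cons, ← hk]
  rw [Finset.mul_sum, Finset.mul_sum]
  refine Finset.sum_congr rfl fun j hj => ?_
  rw [Finset.mul_sum, Finset.mul_sum, Finset.mul_sum]
  refine Finset.sum_congr rfl fun S hS => ?_
  have hj' : j ≤ k 0 := by simpa [Nat.lt_succ_iff] using hj
  have hS' : S.card = k 0 - j := (Finset.mem_powersetCard.1 hS).2
  have hSc : Sᶜ.card = N - S.card := by rw [Finset.card_compl, Fintype.card_fin]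
  have hSN : S.card ≤ N := by simpa using S.card_le_univ
  have hM : N + 2 * j - k 0 = j + Sᶜ.card := by omega
  have hl : j + S.card = k 0 := by omega
  have hC := legConst_pow_mul_contraction m k hy x ξ S j
  rw [hl, ← wickConst_mul] at hC
  rw [hM, Fin.prod_univ_succ]
  have hsq : ((√(((j + Sᶜ.card)! : ℝ) / (N ! : ℝ)) : ℝ) : ℂ) *
      ((√((j + Sᶜ.card)! : ℝ) : ℝ) : ℂ)⁻¹ = ((√(N ! : ℝ) : ℝ) : ℂ)⁻¹ := by
    rw [Real.sqrt_div (by positivity), ← Complex.ofReal_inv, ← Complex.ofReal_mul,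
      ← Complex.ofReal_inv]
    congr 1
    have : √((j + Sᶜ.card)! : ℝ) ≠ 0 := by positivity
    field_simp
  set K := ((√Real.pi ^ k 0 / (2 * Real.pi) ^ (2 * ((k 0 : ℤ) - 1)) : ℝ) : ℂ)
  set q := ((√(((j + Sᶜ.card)! : ℝ) / (N ! : ℝ)) : ℝ) : ℂ)
  rw [← hsq]
  have hgoal : K * (q * (((k 0)! : ℂ) / (j ! : ℂ) *
        (((2 * Real.pi : ℝ) : ℂ)⁻¹ ^ 2 * contraction m k y x ξ S j)))
      = q * (((k 0)! : ℂ) / (j ! : ℂ)) *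
        (K * ((2 * Real.pi : ℝ) : ℂ)⁻¹ ^ 2 * contraction m k y x ξ S j) := by ring
  rw [hgoal, hC, div_eq_mul_inv]
  simp only [Finsupp.tail_apply]
  have e1 : (twoPoints m (Fin.tail y) (Fin.tail x))
      = fun a b : Fin n => twoPoints m y x a.succ b.succ := rfl
  have e2 : ∀ i, outPoly m (Fin.tail y) (y 0) (Fin.tail x) (ξ i) = ∑ a : Fin n,
      MvPolynomial.X a * MvPolynomial.C (outWave m (y a.succ - y 0) (x a.succ) (ξ i)) :=
    fun i => rfl
  rw [e1]
  simp only [e2]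
  ring

/-! ### Smearing -/

lemma integral_cons_mul {n : ℕ} (g : Spacetime → ℂ) (h : (Fin n → Spacetime) → ℂ) :
    ∫ x : Fin (n + 1) → Spacetime, g (x 0) * h (Fin.tail x) = (∫ x, g x) * ∫ x, h x := by
  rw [← integral_prod_mul, ← Measure.volume_eq_prod,
    ← (volume_preserving_piFinSuccAbove (fun _ : Fin (n + 1) => Spacetime) 0).integral_comp'
      (fun q : Spacetime × (Fin n → Spacetime) => g q.1 * h q.2)]
  rfl

lemma integrable_prod_schwartz {n : ℕ} (f : Fin n → 𝓢(Spacetime, ℂ)) :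
    Integrable fun x : Fin n → Spacetime => ∏ i, f i (x i) :=
  Integrable.fintype_prod (μ := fun _ : Fin n => (volume : Measure Spacetime))
    (f := fun i x => f i x) fun i => (f i).integrable

lemma continuous_prod_schwartz {n : ℕ} (f : Fin n → 𝓢(Spacetime, ℂ)) :
    Continuous fun x : Fin n → Spacetime => ∏ i, f i (x i) :=
  continuous_finsetProd _ fun i _ => (f i).continuous.comp (continuous_apply i)

lemma exists_gap {n : ℕ} {y : Fin (n + 1) → ℝ} (hy : StrictMono y) :
    ∃ δ > 0, ∀ a : Fin n, y 0 + δ ≤ y a.succ := by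
  cases n with
  | zero => exact ⟨1, one_pos, fun a => a.elim0⟩
  | succ n =>
    refine ⟨y 1 - y 0, sub_pos.2 (hy Fin.zero_lt_one), fun a => ?_⟩
    rw [add_sub_cancel]
    exact hy.monotone (Fin.succ_le_succ_iff.2 (Fin.zero_le a))

/-- The integrand over the points and the absorbed momenta together. -/
def jointIntegrand (m : ℝ) {n : ℕ} (f : Fin (n + 1) → 𝓢(Spacetime, ℂ)) (k : Fin (n + 1) →₀ ℕ)
    (y : Fin (n + 1) → ℝ) {N : ℕ} (ξ : Fin N → Momentum) (S : Finset (Fin N)) (j : ℕ)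
    (η : Fin j → Momentum) (x : Fin (n + 1) → Spacetime) : ℂ :=
  Complex.exp (-Complex.I *
      (mink (∑ r, onShell m (η r) - ∑ i ∈ S, onShell m (ξ i)) (x 0) : ℂ)) *
    pointState m k.tail (Fin.tail y) (y 0) (Fin.tail x) (j + Sᶜ.card)
      (Fin.append η (ξ ∘ Sᶜ.orderEmbOfFin rfl)) * ∏ i, f i (x i)

lemma tail_strictMono {n : ℕ} {y : Fin (n + 1) → ℝ} (hy : StrictMono y) :
    StrictMono (Fin.tail y) := fun _ _ h => hy (Fin.succ_lt_succ_iff.2 h)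

lemma integrable_jointIntegrand (m : ℝ) {n : ℕ} (f : Fin (n + 1) → 𝓢(Spacetime, ℂ))
    (k : Fin (n + 1) →₀ ℕ) {y : Fin (n + 1) → ℝ} (hy : StrictMono y) {N : ℕ}
    (ξ : Fin N → Momentum) (S : Finset (Fin N)) (j : ℕ) :
    Integrable (Function.uncurry (jointIntegrand m f k y ξ S j))
      ((OmegaPi m (Fin j)).prod volume) := by
  obtain ⟨δ, hδ, hgap⟩ := exists_gap hy
  obtain ⟨-, C, hC⟩ := bddCont_pointState m k.tail (tail_strictMono hy) (b := y 0 + δ) hgap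
    (j + Sᶜ.card)
  have hc0 := (bddCont_pointState m k.tail (tail_strictMono hy) (b := y 0)
    (fun a => hy.monotone (Fin.zero_le _)) (j + Sᶜ.card)).1
  have h1 : Integrable (fun η : Fin j → Momentum => ∏ r, Real.exp (-(δ * energy m (η r))))
      (OmegaPi m (Fin j)) :=
    Integrable.fintype_prod (μ := fun _ : Fin j => Omega m)
      (f := fun _ p => Real.exp (-(δ * energy m p))) fun _ => integrable_exp_neg_energy m hδ
  refine ((h1.mul_prod (integrable_prod_schwartz f).norm).const_mul C).mono' ?_
    (ae_of_all _ fun q => ?_)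
  · refine Continuous.aestronglyMeasurable ?_
    have hon := continuous_onShell m
    have hm : Continuous fun q : (Fin j → Momentum) × (Fin (n + 1) → Spacetime) =>
        mink (∑ r, onShell m (q.1 r) - ∑ i ∈ S, onShell m (ξ i)) (q.2 0) :=
      Continuous.mink (by fun_prop) (by fun_prop)
    have hp : Continuous fun q : (Fin j → Momentum) × (Fin (n + 1) → Spacetime) =>
        (Fin.tail q.2, Fin.append q.1 (ξ ∘ Sᶜ.orderEmbOfFin rfl)) := by
      refine Continuous.prodMk ?_ (continuous_append continuous_fst continuous_const)
      unfold Fin.tail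
      fun_prop
    have h2 := hc0.comp hp
    have h3 := (continuous_prod_schwartz f).comp (continuous_snd (X := Fin j → Momentum))
    have h4 : Continuous fun q : (Fin j → Momentum) × (Fin (n + 1) → Spacetime) =>
        Complex.exp (-Complex.I *
          (mink (∑ r, onShell m (q.1 r) - ∑ i ∈ S, onShell m (ξ i)) (q.2 0) : ℂ)) := by
      fun_prop
    exact (h4.mul h2).mul h3
  · obtain ⟨η, x⟩ := q
    simp only [Function.uncurry, jointIntegrand]
    rw [norm_mul, norm_mul, norm_exp_neg_I_mul, one_mul, pointState_add m _ _ _ δ, norm_mul,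
      Complex.norm_real, Real.norm_of_nonneg (Real.exp_pos _).le, ← Real.exp_sum]
    have h2 : Real.exp (-(δ * ∑ r, energy m (Fin.append η (ξ ∘ Sᶜ.orderEmbOfFin rfl) r)))
        ≤ Real.exp (∑ r, -(δ * energy m (η r))) := by
      rw [Finset.sum_neg_distrib, ← Finset.mul_sum, Fin.sum_univ_add]
      have h3 : 0 ≤ ∑ i, energy m (Fin.append η (ξ ∘ Sᶜ.orderEmbOfFin rfl)
          (Fin.natAdd j i)) := Finset.sum_nonneg fun i _ => energy_nonneg m _
      simp only [Fin.append_left]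
      gcongr
      linarith
    have h3 := hC (Fin.tail x, Fin.append η (ξ ∘ Sᶜ.orderEmbOfFin rfl))
    simp only at h3
    have hC0 : 0 ≤ C := (norm_nonneg _).trans h3
    calc _ ≤ Real.exp (∑ r, -(δ * energy m (η r))) * C * ‖∏ i, f i (x i)‖ := by gcongr
      _ = _ := by ring

lemma integrable_contraction_mul (m : ℝ) {n : ℕ} (f : Fin (n + 1) → 𝓢(Spacetime, ℂ))
    (k : Fin (n + 1) →₀ ℕ) {y : Fin (n + 1) → ℝ} (hy : StrictMono y) {N : ℕ}
    (ξ : Fin N → Momentum) (S : Finset (Fin N)) (j : ℕ) :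
    Integrable fun x : Fin (n + 1) → Spacetime => contraction m k y x ξ S j * ∏ i, f i (x i) := by
  refine (integrable_jointIntegrand m f k hy ξ S j).integral_prod_right.congr
    (ae_of_all _ fun x => ?_)
  simp only [Function.uncurry, jointIntegrand, contraction]
  rw [integral_mul_const]

lemma integral_wickIntegrand_eq (m : ℝ) {n : ℕ} (f : Fin (n + 1) → 𝓢(Spacetime, ℂ))
    (k : Fin (n + 1) →₀ ℕ) {y : Fin (n + 1) → ℝ} (hy : StrictMono y) {N : ℕ}
    (ξ : Fin N → Momentum) (S : Finset (Fin N)) (j : ℕ)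
    {Φ : (M : ℕ) → (Fin M → Momentum) → ℂ}
    (hΦ : ∀ M ζ, Φ M ζ = ∫ x : Fin n → Spacetime,
      pointState m k.tail (Fin.tail y) (y 0) x M ζ * ∏ i, f i.succ (x i)) :
    ∫ η, wickIntegrand m (f 0) Φ ξ S j η ∂(OmegaPi m (Fin j))
      = ((2 * Real.pi : ℝ) : ℂ)⁻¹ ^ 2 *
        ∫ x : Fin (n + 1) → Spacetime, contraction m k y x ξ S j * ∏ i, f i (x i) := by
  have h1 : ∀ η, wickIntegrand m (f 0) Φ ξ S j η = ((2 * Real.pi : ℝ) : ℂ)⁻¹ ^ 2 *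
      ∫ x, jointIntegrand m f k y ξ S j η x := by
    intro η
    rw [wickIntegrand, ftilde, hΦ, mul_assoc, ← integral_cons_mul]
    congr 1
    refine integral_congr_ae (ae_of_all _ fun x => ?_)
    simp only [jointIntegrand]
    rw [Fin.prod_univ_succ]
    simp only [Fin.tail]
    ring
  simp only [h1]
  rw [integral_const_mul, integral_integral_swap (integrable_jointIntegrand m f k hy ξ S j)]
  congr 1
  refine integral_congr_ae (ae_of_all _ fun x => ?_)
  simp only [jointIntegrand, contraction]
  rw [integral_mul_const]

/-- The damped state is obtained by smearing the state with vertices at fixed points. -/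
lemma dampedState_eq_integral (m : ℝ) {n : ℕ} (f : Fin n → 𝓢(Spacetime, ℂ)) (k : Fin n →₀ ℕ)
    {y : Fin n → ℝ} (hy : StrictMono y) {b : ℝ} (hb : ∀ a, b ≤ y a) (N : ℕ)
    (ξ : Fin N → Momentum) :
    dampedState m f k y b N ξ
      = ∫ x : Fin n → Spacetime, pointState m k y b x N ξ * ∏ i, f i (x i) := by
  induction n generalizing b N with
  | zero =>
    have hk : k = 0 := Subsingleton.elim _ _
    have h0 : ∀ x : Fin 0 → Spacetime, pointState m k y b x N ξ = vacFn N ξ := by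
      intro x
      subst hk
      rcases eq_or_ne N 0 with rfl | hN
      · simp [pointState, vacFn, genCoeff]
      · have : Nonempty (Fin N) := ⟨⟨0, Nat.pos_of_ne_zero hN⟩⟩
        simp [pointState, vacFn, genCoeff, outPoly, hN]
    simp only [h0, Finset.univ_eq_empty, Finset.prod_empty, mul_one]
    rw [volume_pi, Measure.pi_of_empty _ (fun i : Fin 0 => i.elim0)]
    simp [dampedState]
  | succ n ih =>
    have hΦ : ∀ M ζ, dampedState m (Fin.tail f) k.tail (Fin.tail y) (y 0) M ζ
        = ∫ x : Fin n → Spacetime, pointState m k.tail (Fin.tail y) (y 0) x M ζ *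
          ∏ i, f i.succ (x i) := fun M ζ =>
      ih (Fin.tail f) k.tail (tail_strictMono hy) (fun a => hy.monotone (Fin.zero_le _)) M ζ
    have hb0 : |y 0 - b| = y 0 - b := abs_of_nonneg (sub_nonneg.2 (hb 0))
    have hps : ∀ x, pointState m k y b x N ξ * ∏ i, f i (x i)
        = (Real.exp (-((y 0 - b) * ∑ r, energy m (ξ r))) : ℂ) *
          (pointState m k y (y 0) x N ξ * ∏ i, f i (x i)) := fun x => by
      rw [pointState_add m k y b (y 0 - b), add_sub_cancel, mul_assoc]
    simp only [hps]
    rw [integral_const_mul, dampedState, damp, hb0]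
    congr 1
    rw [wickValue]
    simp only [integral_wickIntegrand_eq m f k hy ξ _ _ hΦ, ← sum_contraction m k hy _ ξ,
      Finset.sum_mul, mul_assoc]
    have hI := fun S j => integrable_contraction_mul m f k hy ξ S j
    rw [integral_const_mul, integral_finsetSum]
    · congr 1
      refine Finset.sum_congr rfl fun j _ => ?_
      rw [integral_const_mul, integral_finsetSum]
      · congr 1
        refine Finset.sum_congr rfl fun S _ => ?_
        rw [integral_const_mul, integral_const_mul]
      · intro S _
        exact ((hI S j).const_mul _).const_mul _
    · intro j _
      exact (integrable_finsetSum _ fun S _ => ((hI S j).const_mul _).const_mul _).const_mul _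

lemma pointState_zero (m : ℝ) {n : ℕ} (k : Fin n →₀ ℕ) (y : Fin n → ℝ) (b : ℝ)
    (x : Fin n → Spacetime) (ξ : Fin 0 → Momentum) :
    pointState m k y b x 0 ξ = (∏ a, ((k a)! : ℂ)) * MvPowerSeries.coeff k (expTwoPoint m y x) := by
  rw [expTwoPoint, coeff_expSeries, pointState]
  simp only [Nat.factorial_zero, Nat.cast_one, Real.sqrt_one, Complex.ofReal_one, inv_one, mul_one,
    Finset.univ_eq_empty, Finset.prod_empty]
  rfl

lemma coeff_expTwoPoint (m : ℝ) {n : ℕ} (k : Fin n →₀ ℕ) (y : Fin n → ℝ) (b : ℝ)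
    (x : Fin n → Spacetime) (ξ : Fin 0 → Momentum) :
    MvPowerSeries.coeff k (expTwoPoint m y x)
      = (∏ a, ((k a)! : ℂ)⁻¹) * pointState m k y b x 0 ξ := by
  have h : (∏ a, ((k a)! : ℂ)) ≠ 0 :=
    Finset.prod_ne_zero_iff.2 fun a _ => by exact_mod_cast (k a).factorial_ne_zero
  rw [pointState_zero, Finset.prod_inv_distrib, inv_mul_cancel_left₀ h]

end WickExp

end

/-- The identity `(Φ₀, σ^{(1)}(x₁) ⋯ σ^{(n)}(x_n) Φ₀) = exp {∑_{i<j} g_i g_j D_m^{(-)}(x_i - x_j)}`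
of formal power series in `g₁, …, g_n` whose coefficients are distributions in `x₁, …, x_n`. Both
sides are smeared with `f₁(x₁) ⋯ f_n(x_n)`; the distributions on the right are the boundary values,
as `y → 0` with `y₁ < ⋯ < y_n`, of the coefficients at the points with times `x_i⁰ + i y_i`. -/
theorem corollary3p2 (m : ℝ) (hm : 0 ≤ m) (n : ℕ) (f : Fin n → 𝓢(WickExp.Spacetime, ℂ))
    (k : Fin n →₀ ℕ) :
    WickExp.vacuum m ∈ (WickExp.wickExpProdCoeff m f k).domain ∧
    (∀ y : Fin n → ℝ, StrictMono y →
      Integrable (fun x : Fin n → WickExp.Spacetime =>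
        MvPowerSeries.coeff k (WickExp.expTwoPoint m y x) * ∏ i, f i (x i))) ∧
    Tendsto
      (fun y : Fin n → ℝ => ∫ x : Fin n → WickExp.Spacetime,
        MvPowerSeries.coeff k (WickExp.expTwoPoint m y x) * ∏ i, f i (x i))
      (𝓝[{y | StrictMono y}] 0)
      (𝓝 (MvPowerSeries.coeff k (WickExp.vev m f))) := by
  let ξ₀ : Fin 0 → WickExp.Momentum := fun i => i.elim0
  obtain ⟨hdom, hvev⟩ := WickExp.vev_eq hm f k ξ₀
  have hlow : ∀ y : Fin n → ℝ, ∃ b, ∀ a, b ≤ y a := fun y =>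
    (Set.finite_range y).bddBelow.imp fun b hb a => hb ⟨a, rfl⟩
  refine ⟨hdom, fun y hy => ?_, ?_⟩
  · obtain ⟨b, hb⟩ := hlow y
    simp only [WickExp.coeff_expTwoPoint m k y b _ ξ₀]
    have h1 : Continuous fun x : Fin n → WickExp.Spacetime => (x, ξ₀) := by fun_prop
    obtain ⟨hc, C, hC⟩ := (WickExp.BddCont.const (∏ a, ((k a)! : ℂ)⁻¹)).mul
      ((WickExp.bddCont_pointState m k hy hb 0).comp h1)
    exact (WickExp.integrable_prod_schwartz f).bdd_mul hc.aestronglyMeasurable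
      (ae_of_all _ hC)
  · rw [hvev]
    have hcont : Continuous fun y : Fin n → ℝ =>
        (∏ i, ((k i)! : ℂ)⁻¹) * WickExp.dampedState m f k y 0 0 ξ₀ := by
      have h1 : Continuous fun y : Fin n → ℝ => ((y, (0 : ℝ)), ξ₀) := by fun_prop
      exact continuous_const.mul (((WickExp.rapidFamily_dampedState hm f k).cont 0).comp h1)
    refine Tendsto.congr' ?_ (hcont.tendsto 0 |>.mono_left nhdsWithin_le_nhds)
    filter_upwards [self_mem_nhdsWithin] with y hy
    obtain ⟨b, hb⟩ := hlow y
    have h2 : WickExp.dampedState m f k y 0 0 ξ₀ = WickExp.dampedState m f k y b 0 ξ₀ := by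
      cases n with
      | zero => rfl
      | succ n => simp [WickExp.dampedState, WickExp.damp]
    rw [h2, WickExp.dampedState_eq_integral m f k hy hb, ← integral_const_mul]
    refine integral_congr_ae (ae_of_all _ fun x => ?_)
    simp only [WickExp.coeff_expTwoPoint m k y b _ ξ₀, mul_assoc]
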